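/- Let $\alpha,\beta>-1$. Write $(c)_0=1$, $(c)_k=c(c+1)\cdots(c+k-1)$, and let $$R_n^{(\alpha,\beta)}(x)=\sum_{k=0}^n\frac{(-n)_k(n+\alpha+\beta+1)_k}{(\alpha+1)_k}\frac{(1-x)^k}{2^k k!}\qquad(n\in\mathbb{N}_0)$$ be the Jacobi polynomials normalized by $R_n^{(\alpha,\beta)}(1)=1$. The generalized Chebyshev polynomials are defined by $$T_{2n}^{(\alpha,\beta)}(x)=R_n^{(\alpha,\beta)}(2x^2-1),\qquad T_{2n+1}^{(\alpha,\beta)}(x)=x\,R_n^{(\alpha,\beta+1)}(2x^2-1)\qquad(n\in\mathbb{N}_0).$$ For all $m,n\in\mathbb{N}_0$ there is a unique expansion $$T_m^{(\alpha,\beta)}(x)\,T_n^{(\alpha,\beta)}(x)=\sum_{k=|m-n|}^{m+n}g_T(m,n;k)\,T_k^{(\alpha,\beta)}(x)$$ with real coefficients $g_T(m,n;k)$, and the following are equivalent: (i) $(T_n^{(\alpha,\beta)})_{n\in\mathbb{N}_0}$ satisfies nonnegative linearization of products, i.e., $g_T(m,n;k)\ge 0$ for all $m,n\in\mathbb{N}_0$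 and all $|m-n|\le k\le m+n$. (ii) $(\alpha,\beta)\in V$, where, with $a:=\alpha+\beta+1$ and $b:=\alpha-\beta$, $$V:=\left\{(\alpha,\beta)\in(-1,\infty)^2:\ a(a+5)(a+3)^2\ge(a^2-7a-24)\,b^2,\ b\ge 0\right\}.$$ -/

import Mathlib

open Polynomial

noncomputable section

namespace GenCheb

/-- The Jacobi polynomial `R_n^{(α,β)}`, normalized by `R_n^{(α,β)}(1) = 1`:
`∑_{k=0}^n (-n)_k (n+α+β+1)_k / (α+1)_k * (1-x)^k / (2^k k!)`, where `(c)_k` is the rising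
factorial `c (c+1) ⋯ (c+k-1)`. -/
def jacobi (α β : ℝ) (n : ℕ) : ℝ[X] :=
  ∑ k ∈ Finset.range (n + 1),
    C ((ascPochhammer ℝ k).eval (-(n : ℝ)) * (ascPochhammer ℝ k).eval ((n : ℝ) + α + β + 1)
        / ((ascPochhammer ℝ k).eval (α + 1) * (2 ^ k * (k.factorial : ℝ)))) * (1 - X) ^ k

/-- The generalized Chebyshev polynomial `T_n^{(α,β)}`:
`T_{2n}(x) = R_n^{(α,β)}(2x²-1)` and `T_{2n+1}(x) = x R_n^{(α,β+1)}(2x²-1)`. -/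
def genChebyshev (α β : ℝ) (n : ℕ) : ℝ[X] :=
  if Even n then (jacobi α β (n / 2)).comp (2 * X ^ 2 - 1)
  else X * (jacobi α (β + 1) (n / 2)).comp (2 * X ^ 2 - 1)

theorem genChebyshev_even (α β : ℝ) (n : ℕ) :
    genChebyshev α β (2 * n) = (jacobi α β n).comp (2 * X ^ 2 - 1) := by
  simp [genChebyshev]

theorem genChebyshev_odd (α β : ℝ) (n : ℕ) :
    genChebyshev α β (2 * n + 1) = X * (jacobi α (β + 1) n).comp (2 * X ^ 2 - 1) := by
  have h : (2 * n + 1) / 2 = n := by omega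
  simp [genChebyshev, h]

/-- `g` is the array of linearization coefficients of the polynomial sequence `P`:
`P_m P_n = ∑_{k=|m-n|}^{m+n} g(m,n;k) P_k` for all `m, n`. Entries outside the
summation range, which do not occur in the expansions, are set to zero. -/
def IsLinearization (P : ℕ → ℝ[X]) (g : ℕ → ℕ → ℕ → ℝ) : Prop :=
  ∀ m n : ℕ,
    P m * P n = ∑ k ∈ Finset.Icc ((m : ℤ) - (n : ℤ)).natAbs (m + n), C (g m n k) * P k ∧
    ∀ k : ℕ, k ∉ Finset.Icc ((m : ℤ) - (n : ℤ)).natAbs (m + n) → g m n k = 0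

/-- Gasper's set `V`, with `a = α + β + 1` and `b = α - β`. -/
def gasperV : Set (ℝ × ℝ) :=
  {p | -1 < p.1 ∧ -1 < p.2 ∧
    let a := p.1 + p.2 + 1
    let b := p.1 - p.2
    a * (a + 5) * (a + 3) ^ 2 ≥ (a ^ 2 - 7 * a - 24) * b ^ 2 ∧ b ≥ 0}

end GenCheb

end

/-! In the variable y = 1 - x² the even-index polynomials are Jacobi polynomials for the weight y^α
(1 - y)^β, and the odd-index ones are x times those with β raised by one. One moment functional
(`chebFunctional`) makes the whole sequence orthogonal with positive norms, so each linearization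
coefficient is a triple product integral divided by a norm (`isLinearization_iff`); this settles
existence and uniqueness. By parity only two kinds of integrals survive: `tripleE`, with three even
indices, and `tripleO`, with two odd ones.

Necessity needs two coefficients: `tripleE` at (1,1,1) has the sign of b, and at (2,2,2) the sign of
`topFactor a b 2 2`, which is the difference of the two sides in the inequality defining V.

For sufficiency, `tripleE` satisfies a three-term recurrence in its last index
(`tripleE_three_term`). Its middle coefficient has the sign of b times a convex quadratic in J(J +
a), which is nonpositive at the lower end wherever the recurrence is used. Hence the middle
coefficient changes sign at most once, and nonnegativity spreads inward from both ends
(`nonneg_of_three_term`). The end values are explicit: the extreme ones are positive, the next have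
the sign of b, the third the sign of `topFactor`. If a > 0 the recurrence reaches the ends. If a ≤ 0
its outer coefficients lose positivity there, it must start one index further in, and the third
values enter; `topFactor_nonneg` shows that the pair (2,2) is the decisive one.

Finally `tripleO` is a combination of a `tripleO` of smaller index sum and a `tripleE`. The weights
are nonnegative up to boundary cases; those arising for a < 0 are evaluated in closed form and
controlled by b ≥ -2a (`tripleO_nonneg`). -/

noncomputable section

namespace GenCheb

/-! ### Jacobi polynomials as hypergeometric sums in y -/

/-- The coefficients of the Jacobi polynomial in powers of `y = (1 - x) / 2`. -/
def jacobiCoeff (α β : ℝ) (n k : ℕ) : ℝ :=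
  (ascPochhammer ℝ k).eval (-(n : ℝ)) * (ascPochhammer ℝ k).eval ((n : ℝ) + α + β + 1)
    / ((ascPochhammer ℝ k).eval (α + 1) * (k.factorial : ℝ))

/-- The Jacobi polynomial as a polynomial in `y = (1 - x) / 2`. -/
def jacobiY (α β : ℝ) (n : ℕ) : ℝ[X] :=
  ∑ k ∈ Finset.range (n + 1), C (jacobiCoeff α β n k) * X ^ k

theorem ascPochhammer_eval_succ (k : ℕ) (c : ℝ) :
    (ascPochhammer ℝ (k + 1)).eval c = (ascPochhammer ℝ k).eval c * (c + k) :=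
  ascPochhammer_succ_eval k c

theorem ascPochhammer_eval_succ_left (k : ℕ) (c : ℝ) :
    (ascPochhammer ℝ (k + 1)).eval c = c * (ascPochhammer ℝ k).eval (c + 1) := by
  rw [ascPochhammer_succ_left]
  simp [eval_comp]

theorem ascPochhammer_eval_pos (k : ℕ) {c : ℝ} (hc : 0 < c) :
    0 < (ascPochhammer ℝ k).eval c :=
  ascPochhammer_pos k c hc

theorem ascPochhammer_eval_neg_nat_of_lt {n k : ℕ} (h : n < k) :
    (ascPochhammer ℝ k).eval (-(n : ℝ)) = 0 := by
  induction k with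
  | zero => omega
  | succ k ih =>
    rw [ascPochhammer_eval_succ]
    rcases Nat.lt_succ_iff_lt_or_eq.mp h with h' | h'
    · rw [ih h', zero_mul]
    · subst h'; simp

theorem ascPochhammer_eval_neg_nat_ne_zero {n k : ℕ} (h : k ≤ n) :
    (ascPochhammer ℝ k).eval (-(n : ℝ)) ≠ 0 := by
  induction k with
  | zero => simp
  | succ k ih =>
    rw [ascPochhammer_eval_succ]
    have h1 : (k : ℝ) < n := by exact_mod_cast h
    exact mul_ne_zero (ih (by omega)) (by linarith)

theorem jacobiCoeff_eq_zero (α β : ℝ) {n k : ℕ} (h : n < k) : jacobiCoeff α β n k = 0 := by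
  simp [jacobiCoeff, ascPochhammer_eval_neg_nat_of_lt h]

theorem coeff_jacobiY (α β : ℝ) (n k : ℕ) : (jacobiY α β n).coeff k = jacobiCoeff α β n k := by
  simp only [jacobiY, finsetSum_coeff, coeff_C_mul, coeff_X_pow]
  by_cases h : k < n + 1
  · rw [Finset.sum_eq_single k] <;> simp +contextual [eq_comm, h]
  · rw [jacobiCoeff_eq_zero α β (by omega)]
    apply Finset.sum_eq_zero
    intro i hi
    have : k ≠ i := by rintro rfl; exact h (Finset.mem_range.mp hi)
    simp [this]

/-! ### Contiguous and differential relations of Jacobi polynomials -/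

section structure_relations

variable {α β : ℝ}

theorem jacobiCoeff_zero (n : ℕ) : jacobiCoeff α β n 0 = 1 := by simp [jacobiCoeff]

theorem jacobiCoeff_succ (hα : -1 < α) (n k : ℕ) :
    jacobiCoeff α β n (k + 1) * ((α + 1 + k) * (k + 1)) =
      jacobiCoeff α β n k * ((k - n) * (n + α + β + 1 + k)) := by
  have h1 := (ascPochhammer_eval_pos k (c := α + 1) (by linarith)).ne'
  have h2 : (k.factorial : ℝ) ≠ 0 := by positivity
  have h3 : (α + 1 + k) ≠ 0 := by have : (0:ℝ) ≤ k := k.cast_nonneg; linarith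
  have h4 : (k + 1 : ℝ) ≠ 0 := by positivity
  simp only [jacobiCoeff, ascPochhammer_eval_succ, Nat.factorial_succ]
  push_cast
  field_simp
  ring

/-- Raising β moves only the upper parameter c = n + α + β + 1, and c (c + 1)_k = (c + k) (c)_k. -/
theorem jacobiCoeff_shift (n k : ℕ) :
    (n + α + β + 1) * jacobiCoeff α (β + 1) n k =
      (n + α + β + 1 + k) * jacobiCoeff α β n k := by
  have h := ascPochhammer_eval_succ_left k (n + α + β + 1)
  rw [ascPochhammer_eval_succ] at h
  have h' : (n : ℝ) + α + (β + 1) + 1 = n + α + β + 1 + 1 := by ring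
  simp only [jacobiCoeff, h']
  linear_combination (-(ascPochhammer ℝ k).eval (-(n : ℝ)) /
    ((ascPochhammer ℝ k).eval (α + 1) * (k.factorial : ℝ))) * h

/-- Degree n with β + 1 and degree n + 1 with β share the upper parameter n + α + β + 2, so only the
other one moves, from -(n + 1) to -n. -/
theorem jacobiCoeff_shift_pred (n k : ℕ) :
    ((n + 1 : ℕ) : ℝ) * jacobiCoeff α (β + 1) n k =
      (((n + 1 : ℕ) : ℝ) - k) * jacobiCoeff α β (n + 1) k := by
  have h := ascPochhammer_eval_succ_left k (-((n + 1 : ℕ) : ℝ))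
  rw [ascPochhammer_eval_succ] at h
  have h' : (n : ℝ) + α + (β + 1) + 1 = ((n + 1 : ℕ) : ℝ) + α + β + 1 := by push_cast; ring
  have h'' : -((n + 1 : ℕ) : ℝ) + 1 = -(n : ℝ) := by push_cast; ring
  rw [h''] at h
  simp only [jacobiCoeff, h']
  linear_combination ((ascPochhammer ℝ k).eval (((n + 1 : ℕ) : ℝ) + α + β + 1) /
    ((ascPochhammer ℝ k).eval (α + 1) * (k.factorial : ℝ))) * h

theorem coeff_X_mul_derivative (f : ℝ[X]) (k : ℕ) :
    (X * derivative f).coeff k = k * f.coeff k := by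
  cases k with
  | zero => simp
  | succ k => rw [coeff_X_mul, coeff_derivative]; push_cast; ring

theorem jacobiY_shift (n : ℕ) :
    C (n + α + β + 1) * jacobiY α (β + 1) n =
      C (n + α + β + 1) * jacobiY α β n + X * derivative (jacobiY α β n) := by
  ext k
  rw [coeff_add, coeff_C_mul, coeff_C_mul, coeff_X_mul_derivative, coeff_jacobiY, coeff_jacobiY,
    jacobiCoeff_shift]
  ring

theorem jacobiY_shift_pred (n : ℕ) :
    C ((n + 1 : ℕ) : ℝ) * jacobiY α (β + 1) n =
      C ((n + 1 : ℕ) : ℝ) * jacobiY α β (n + 1) - X * derivative (jacobiY α β (n + 1)) := by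
  ext k
  rw [coeff_sub, coeff_C_mul, coeff_C_mul, coeff_X_mul_derivative, coeff_jacobiY, coeff_jacobiY,
    jacobiCoeff_shift_pred]
  ring

theorem derivative_jacobiY_shift (hα : -1 < α) (n : ℕ) :
    C (n + α + β + 1) * ((1 - X) * derivative (jacobiY α (β + 1) n) +
      C (n : ℝ) * jacobiY α (β + 1) n) = C (n + β + 1) * derivative (jacobiY α β n) := by
  ext k
  rw [sub_mul, one_mul, coeff_C_mul, coeff_C_mul, coeff_add, coeff_sub, coeff_C_mul,
    coeff_X_mul_derivative, coeff_derivative, coeff_derivative, coeff_jacobiY, coeff_jacobiY,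
    coeff_jacobiY]
  have h3 : (α + 1 + k) ≠ 0 := by have : (0:ℝ) ≤ k := k.cast_nonneg; linarith
  have h1 := jacobiCoeff_succ (β := β) hα n k
  have h2 := jacobiCoeff_succ (β := β + 1) hα n k
  have h4 := jacobiCoeff_shift (α := α) (β := β) n k
  apply mul_left_cancel₀ h3
  linear_combination (n + α + β + 1) * h2 - (n + β + 1) * h1 - (n - k) * (n + β + 1) * h4

theorem jacobiY_ode (hα : -1 < α) (n : ℕ) :
    X * (1 - X) * derivative (derivative (jacobiY α β n)) +
      (C (α + 1) - C (α + β + 2) * X) * derivative (jacobiY α β n) =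
      - (C (n * (n + α + β + 1)) * jacobiY α β n) := by
  have e : X * (1 - X) * derivative (derivative (jacobiY α β n)) +
      (C (α + 1) - C (α + β + 2) * X) * derivative (jacobiY α β n) =
      X * derivative (derivative (jacobiY α β n)) + C (α + 1) * derivative (jacobiY α β n)
      - X * derivative (X * derivative (jacobiY α β n))
      - C (α + β + 1) * (X * derivative (jacobiY α β n)) := by
    simp only [derivative_mul, derivative_X, C_add, C_1]
    have : (C 2 : ℝ[X]) = 2 := rfl
    rw [this]
    ring
  rw [e]
  ext k
  simp only [coeff_sub, coeff_add, coeff_neg, coeff_C_mul, coeff_X_mul_derivative,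
    coeff_derivative, coeff_jacobiY]
  linear_combination jacobiCoeff_succ (β := β) hα n k

/-- With 1 - y = x² this is the recurrence that expands x T_{2n+1} in T_{2n+2} and T_{2n}. -/
theorem one_sub_X_mul_jacobiY (hα : -1 < α) (n : ℕ) :
    C (2 * n + α + β + 2) * ((1 - X) * jacobiY α (β + 1) n) =
      C (n + 1 + α) * jacobiY α β (n + 1) + C (n + 1 + β) * jacobiY α β n := by
  ext k
  rw [sub_mul, one_mul, coeff_C_mul, coeff_add, coeff_C_mul, coeff_C_mul, coeff_sub]
  cases k with
  | zero =>
    rw [coeff_X_mul_zero]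
    simp only [coeff_jacobiY, jacobiCoeff_zero]
    ring
  | succ k =>
    rw [coeff_X_mul]
    simp only [coeff_jacobiY]
    have h3 : (α + 1 + k) ≠ 0 := by have : (0:ℝ) ≤ k := k.cast_nonneg; linarith
    have h5 : (k + 1 : ℝ) ≠ 0 := by positivity
    have h1 := jacobiCoeff_succ (β := β) hα n k
    have h2 := jacobiCoeff_succ (β := β + 1) hα n k
    have h4 := jacobiCoeff_shift (α := α) (β := β) n k
    have h6 := jacobiCoeff_shift_pred (α := α) (β := β) n k
    have h7 := jacobiCoeff_succ (β := β) hα (n + 1) k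
    push_cast at h6 h7
    apply mul_left_cancel₀ (mul_ne_zero h3 h5)
    linear_combination (2 * n + α + β + 2) * h2 - (n + 1 + α) * h7 - (n + 1 + β) * h1
      - (n + 1 + α) * (n + α + β + 2 + k) * h6 + (n + 1 + β) * (k - n) * h4

end structure_relations

/-! ### The Beta moment functional and integration by parts -/

/-- The moment functional of the Jacobi weight `y^α (1 - y)^β` on `(0, 1)`, with total mass one. -/
def jacobiFunctional (α β : ℝ) : ℝ[X] →ₗ[ℝ] ℝ :=
  (Polynomial.basisMonomials ℝ).constr ℝ fun n =>
    (ascPochhammer ℝ n).eval (α + 1) / (ascPochhammer ℝ n).eval (α + β + 2)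

theorem jacobiFunctional_monomial (α β : ℝ) (n : ℕ) :
    jacobiFunctional α β (monomial n 1) =
      (ascPochhammer ℝ n).eval (α + 1) / (ascPochhammer ℝ n).eval (α + β + 2) := by
  have := (Polynomial.basisMonomials ℝ).constr_basis ℝ (fun n =>
    (ascPochhammer ℝ n).eval (α + 1) / (ascPochhammer ℝ n).eval (α + β + 2)) n
  simpa [jacobiFunctional] using this

theorem jacobiFunctional_one (α β : ℝ) : jacobiFunctional α β 1 = 1 := by
  have := jacobiFunctional_monomial α β 0
  simpa using this

theorem jacobiFunctional_C_mul (α β c : ℝ) (f : ℝ[X]) :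
    jacobiFunctional α β (C c * f) = c * jacobiFunctional α β f := by
  rw [← smul_eq_C_mul, map_smul, smul_eq_mul]

/-- Integration by parts for the Jacobi weight. -/
theorem jacobiFunctional_pearson {α β : ℝ} (hα : -1 < α) (hβ : -1 < β) (f : ℝ[X]) :
    jacobiFunctional α β (X * (1 - X) * derivative f + (C (α + 1) - C (α + β + 2) * X) * f) = 0 := by
  induction f using Polynomial.induction_on' with
  | add p q hp hq =>
    have e : X * (1 - X) * derivative (p + q) + (C (α + 1) - C (α + β + 2) * X) * (p + q) =
        (X * (1 - X) * derivative p + (C (α + 1) - C (α + β + 2) * X) * p) +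
        (X * (1 - X) * derivative q + (C (α + 1) - C (α + β + 2) * X) * q) := by
      rw [derivative_add]
      ring
    rw [e, map_add, hp, hq, add_zero]
  | monomial n c =>
    have h1 : (X * (1 - X) * derivative (monomial n c) +
        (C (α + 1) - C (α + β + 2) * X) * monomial n c : ℝ[X]) =
        C (c * (α + 1 + n)) * monomial n 1 - C (c * (α + β + 2 + n)) * monomial (n + 1) 1 := by
      have e : (X * (1 - X) * derivative (monomial n c) +
        (C (α + 1) - C (α + β + 2) * X) * monomial n c : ℝ[X]) =
          (1 - X) * (X * derivative (monomial n c)) +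
        (C (α + 1) - C (α + β + 2) * X) * monomial n c := by ring
      have e2 : (X * derivative (monomial n c) : ℝ[X]) = C (n : ℝ) * monomial n c := by
        ext k
        rw [coeff_X_mul_derivative, coeff_C_mul, coeff_monomial]
        split_ifs with h
        · rw [h]
        · simp
      have e3 : (monomial n c : ℝ[X]) = C c * monomial n 1 := by simp [C_mul_monomial]
      have e4 : (monomial (n + 1) 1 : ℝ[X]) = X * monomial n 1 := by
        rw [X_mul_monomial]
      rw [e, e2, e3, e4]
      simp only [C_mul, C_add]
      ring
    rw [h1, map_sub, jacobiFunctional_C_mul, jacobiFunctional_C_mul, jacobiFunctional_monomial,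
      jacobiFunctional_monomial, ascPochhammer_eval_succ, ascPochhammer_eval_succ]
    have h2 := (ascPochhammer_eval_pos n (c := α + β + 2) (by linarith)).ne'
    have h3 : (α + β + 2 + n) ≠ 0 := by have : (0:ℝ) ≤ n := n.cast_nonneg; linarith
    field_simp
    ring

/-- The Jacobi operator is symmetric. -/
theorem jacobiFunctional_symm {α β : ℝ} (hα : -1 < α) (hβ : -1 < β) (f g : ℝ[X]) :
    jacobiFunctional α β ((X * (1 - X) * derivative (derivative f) +
      (C (α + 1) - C (α + β + 2) * X) * derivative f) * g) =
      - jacobiFunctional α β (X * (1 - X) * derivative f * derivative g) := by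
  have h := jacobiFunctional_pearson hα hβ (derivative f * g)
  rw [derivative_mul] at h
  rw [eq_neg_iff_add_eq_zero, ← map_add, ← h]
  congr 1
  ring

/-! ### Linear relations between triple product integrals -/

section relations

variable (α β : ℝ)

/-- The integral of `T_{2m} T_{2n} T_{2k}`. -/
def tripleE (m n k : ℕ) : ℝ :=
  jacobiFunctional α β (jacobiY α β m * jacobiY α β n * jacobiY α β k)

/-- The integral of `T_{2m} T_{2n+1} T_{2k+1}`. -/
def tripleO (m n k : ℕ) : ℝ :=
  jacobiFunctional α β
    ((1 - X) * (jacobiY α β m * jacobiY α (β + 1) n * jacobiY α (β + 1) k))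

/-- The integral of `x T_{2n+1} T_{2m} T_{2k}`. -/
def tripleZ (n m k : ℕ) : ℝ :=
  jacobiFunctional α β ((1 - X) * (jacobiY α (β + 1) n * jacobiY α β m * jacobiY α β k))

theorem tripleE_swap (m n k : ℕ) : tripleE α β m n k = tripleE α β n m k := by
  rw [tripleE, tripleE]; congr 1; ring

theorem tripleE_swap' (m n k : ℕ) : tripleE α β m n k = tripleE α β m k n := by
  rw [tripleE, tripleE]; congr 1; ring

theorem tripleO_swap (m n k : ℕ) : tripleO α β m n k = tripleO α β m k n := by
  rw [tripleO, tripleO]; congr 1; ring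

variable {α β}

/-- The extra factor x in the auxiliary integral can be absorbed by the odd factor, as here, or by
an even one, as in `tripleZ_eq_tripleO`. Comparing the two links `tripleE` with `tripleO`. -/
theorem tripleZ_eq_tripleE (hα : -1 < α) (n m k : ℕ) :
    (2 * n + α + β + 2) * tripleZ α β n m k =
      (n + 1 + α) * tripleE α β (n + 1) m k + (n + 1 + β) * tripleE α β n m k := by
  rw [tripleZ, tripleE, tripleE, ← jacobiFunctional_C_mul, ← jacobiFunctional_C_mul,
    ← jacobiFunctional_C_mul, ← map_add]
  congr 1
  linear_combination (jacobiY α β m * jacobiY α β k) * one_sub_X_mul_jacobiY (β := β) hα n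

/-- The companion recurrence, for x T_{2n}, divided by x. At n = 0 the truncated index `n - 1` is
harmless because its coefficient vanishes. -/
theorem two_mul_add_mul_jacobiY (n : ℕ) :
    C (2 * n + α + β + 1) * jacobiY α β n =
      C (n + α + β + 1) * jacobiY α (β + 1) n + C (n : ℝ) * jacobiY α (β + 1) (n - 1) := by
  have h1 := jacobiY_shift (α := α) (β := β) n
  cases n with
  | zero =>
    have : jacobiY α β 0 = jacobiY α (β + 1) 0 := by simp [jacobiY, jacobiCoeff_zero]
    simp [this]
  | succ n =>
    have h2 := jacobiY_shift_pred (α := α) (β := β) n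
    rw [Nat.add_sub_cancel]
    have e : (C (2 * ((n + 1 : ℕ) : ℝ) + α + β + 1) : ℝ[X]) =
        C (((n + 1 : ℕ) : ℝ) + α + β + 1) + C ((n + 1 : ℕ) : ℝ) := by
      rw [← C_add]; congr 1; ring
    rw [e]
    linear_combination -h1 - h2

theorem tripleZ_eq_tripleO (n m k : ℕ) :
    (2 * m + α + β + 1) * tripleZ α β n m k =
      (m + α + β + 1) * tripleO α β k m n + m * tripleO α β k (m - 1) n := by
  rw [tripleZ, tripleO, tripleO, ← jacobiFunctional_C_mul, ← jacobiFunctional_C_mul,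
    ← jacobiFunctional_C_mul, ← map_add]
  congr 1
  linear_combination ((1 - X) * jacobiY α (β + 1) n * jacobiY α β k) *
    two_mul_add_mul_jacobiY (α := α) (β := β) m

theorem one_sub_X_mul_derivative_jacobiY (hα : -1 < α) (hβ : -1 < β) (n : ℕ) :
    C (n + β + 1) * (jacobiY α β n - (1 - X) * jacobiY α (β + 1) n) =
      X * (C (β + 1) * jacobiY α (β + 1) n - (1 - X) * derivative (jacobiY α (β + 1) n)) := by
  -- The proof cancels n + α + β + 1, which can be zero when n = 0.
  cases n with
  | zero => simp [jacobiY, jacobiCoeff_zero]; ring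
  | succ n =>
    have h0 : (((n + 1 : ℕ) : ℝ) + α + β + 1) ≠ 0 := by
      have : (0:ℝ) ≤ n := n.cast_nonneg
      push_cast; linarith
    have h1 := jacobiY_shift (α := α) (β := β) (n + 1)
    have h2 := derivative_jacobiY_shift (β := β) hα (n + 1)
    have h3 : (C (((n + 1 : ℕ) : ℝ) + α + β + 1) : ℝ[X]) ≠ 0 := C_ne_zero.mpr h0
    have e : (C (((n + 1 : ℕ) : ℝ) + β + 1) : ℝ[X]) = C ((n + 1 : ℕ) : ℝ) + C (β + 1) := by
      rw [← C_add]; congr 1; ring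
    apply mul_left_cancel₀ h3
    rw [e] at h2 ⊢
    linear_combination X * h2 - (C ((n + 1 : ℕ) : ℝ) + C (β + 1)) * h1

/-- The sum relation, from integrating a total derivative. -/
theorem tripleO_add_tripleO (hα : -1 < α) (hβ : -1 < β) (m n k : ℕ) :
    (m + α + β + 1) * tripleO α β k m n + (k + α + β + 1) * tripleO α β m n k =
      (m + k - n + α + β) * tripleZ α β n m k + (n + β + 1) * tripleE α β m n k := by
  -- The integral of the total derivative vanishes; the three relations below then trade every
  -- derivative for an undifferentiated polynomial.
  have h := jacobiFunctional_pearson hα hβ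
    (jacobiY α β m * jacobiY α (β + 1) n * jacobiY α β k)
  have hm := jacobiY_shift (α := α) (β := β) m
  have hk := jacobiY_shift (α := α) (β := β) k
  have hn := one_sub_X_mul_derivative_jacobiY hα hβ n
  simp only [tripleZ, tripleO, tripleE]
  simp only [← jacobiFunctional_C_mul, ← map_add]
  rw [← sub_eq_zero, ← map_sub, ← h]
  congr 1
  simp only [derivative_mul, C_add, C_sub, C_1] at *
  have : (C 2 : ℝ[X]) = 2 := rfl
  rw [this]
  set u := jacobiY α β m
  set w := jacobiY α β k
  set v := jacobiY α (β + 1) n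
  linear_combination ((1 - X) * v * w) * hm + ((1 - X) * v * u) * hk - u * w * hn

/-- The difference relation, from the symmetry of the Jacobi operator. -/
theorem tripleO_sub_tripleO (hα : -1 < α) (hβ : -1 < β) (m n k : ℕ) :
    (n + 1) * (n + α + β + 1) * ((m + α + β + 1) * tripleO α β k m n -
      (k + α + β + 1) * tripleO α β m n k - (m - k) * tripleZ α β n m k) =
      (m - k) * (m + k + α + β + 1) *
        ((n + β + 1) * tripleE α β m n k - (n + α + β + 1) * tripleZ α β n m k) := by
  -- An antiderivative of a multiple of the shifted polynomial v of degree n. For eigenfunctions u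
  -- and w, symmetry of the operator turns the eigenvalue difference times ∫ u w q into ∫ y(1 -
  -- y)(u'w - uw') q'.
  set q := C (n + β + 1) * jacobiY α β n - C (n + α + β + 1) * ((1 - X) * jacobiY α (β + 1) n)
    with hq
  have hq' : derivative q = C ((n + 1) * (n + α + β + 1)) * jacobiY α (β + 1) n := by
    have h2 := derivative_jacobiY_shift (β := β) hα n
    rw [hq]
    simp only [derivative_sub, derivative_mul, derivative_C, derivative_one, derivative_X]
    simp only [C_mul, C_add, C_1] at *
    linear_combination -h2
  have hm := jacobiY_shift (α := α) (β := β) m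
  have hk := jacobiY_shift (α := α) (β := β) k
  have s1 := jacobiFunctional_symm hα hβ (jacobiY α β m) (jacobiY α β k * q)
  have s2 := jacobiFunctional_symm hα hβ (jacobiY α β k) (jacobiY α β m * q)
  rw [jacobiY_ode hα] at s1 s2
  have e1 : jacobiFunctional α β (C ((n + 1) * (n + α + β + 1)) *
      ((X * (1 - X)) * ((derivative (jacobiY α β m) * jacobiY α β k -
        jacobiY α β m * derivative (jacobiY α β k)) * jacobiY α (β + 1) n))) =
      (m - k) * (m + k + α + β + 1) *
        jacobiFunctional α β (jacobiY α β m * jacobiY α β k * q) := by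
    have t1 : jacobiFunctional α β (X * (1 - X) * derivative (jacobiY α β m) *
          derivative (jacobiY α β k * q)) -
        jacobiFunctional α β (X * (1 - X) * derivative (jacobiY α β k) *
          derivative (jacobiY α β m * q)) =
        jacobiFunctional α β (C ((m - k) * (m + k + α + β + 1)) *
          (jacobiY α β m * jacobiY α β k * q)) := by
      rw [← neg_inj, neg_sub', ← s1, ← s2, ← map_neg, ← map_sub]
      congr 1
      simp only [C_mul, C_add, C_sub, C_1]
      ring
    rw [← jacobiFunctional_C_mul, ← t1, ← map_sub]
    congr 1
    rw [derivative_mul, derivative_mul, hq']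
    ring
  have e2 : jacobiFunctional α β (jacobiY α β m * jacobiY α β k * q) =
      (n + β + 1) * tripleE α β m n k - (n + α + β + 1) * tripleZ α β n m k := by
    rw [tripleE, tripleZ, ← jacobiFunctional_C_mul, ← jacobiFunctional_C_mul, ← map_sub]
    congr 1
    rw [hq]
    ring
  rw [← e2, ← e1]
  simp only [tripleZ, tripleO]
  simp only [← jacobiFunctional_C_mul, ← map_sub]
  congr 1
  simp only [C_mul, C_add, C_sub, C_1] at *
  set u := jacobiY α β m
  set w := jacobiY α β k
  set v := jacobiY α (β + 1) n
  linear_combination ((C (n : ℝ) + 1) * (C (n : ℝ) + C α + C β + 1)) *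
    (((1 - X) * v * w) * hm - ((1 - X) * v * u) * hk)

end relations

/-! ### Linearization coefficients of an abstract orthogonal sequence -/

section orthogonal_sequence

variable {P : ℕ → ℝ[X]} {L : ℝ[X] →ₗ[ℝ] ℝ}

theorem map_C_mul (L : ℝ[X] →ₗ[ℝ] ℝ) (c : ℝ) (f : ℝ[X]) : L (C c * f) = c * L f := by
  rw [← smul_eq_C_mul, map_smul, smul_eq_mul]

theorem degree_sub_C_mul_lt (hdeg : ∀ n, (P n).natDegree ≤ n) (hlead : ∀ n, (P n).coeff n ≠ 0)
    {N : ℕ} {f : ℝ[X]} (hf : f.degree < ((N + 1 : ℕ) : WithBot ℕ)) :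
    (f - C (f.coeff N / (P N).coeff N) * P N).degree < N := by
  rw [degree_lt_iff_coeff_zero] at hf ⊢
  intro k hk
  rw [coeff_sub, coeff_C_mul]
  rcases eq_or_lt_of_le hk with h | h
  · rw [← h, div_mul_cancel₀ _ (hlead N), sub_self]
  · rw [hf k h, coeff_eq_zero_of_natDegree_lt (lt_of_le_of_lt (hdeg N) h)]; ring

theorem map_mul_eq_zero_of_degree_lt (hdeg : ∀ n, (P n).natDegree ≤ n)
    (hlead : ∀ n, (P n).coeff n ≠ 0) (horth : ∀ i j, i ≠ j → L (P i * P j) = 0) {n : ℕ}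
    {f : ℝ[X]} (hf : f.degree < n) : L (P n * f) = 0 := by
  have key : ∀ N ≤ n, ∀ f : ℝ[X], f.degree < N → L (P n * f) = 0 := by
    intro N
    induction N with
    | zero =>
      intro _ f hf
      have : f = 0 := by simpa [Nat.WithBot.lt_zero_iff] using hf
      simp [this]
    | succ N ih =>
      intro hN f hf
      have h2 := ih (by omega) _ (degree_sub_C_mul_lt hdeg hlead hf)
      rw [mul_sub, map_sub, mul_left_comm, map_C_mul, horth n N (by omega), mul_zero,
        sub_zero] at h2
      exact h2
  exact key n le_rfl f hf

theorem eq_sum_of_degree_lt (hdeg : ∀ n, (P n).natDegree ≤ n)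
    (hlead : ∀ n, (P n).coeff n ≠ 0) (horth : ∀ i j, i ≠ j → L (P i * P j) = 0)
    (hpos : ∀ i, 0 < L (P i * P i)) {N : ℕ} {f : ℝ[X]} (hf : f.degree < N) :
    f = ∑ k ∈ Finset.range N, C (L (f * P k) / L (P k * P k)) * P k := by
  induction N generalizing f with
  | zero => simpa [Nat.WithBot.lt_zero_iff] using hf
  | succ N ih =>
    set c := f.coeff N / (P N).coeff N with hc
    have h1 := degree_sub_C_mul_lt hdeg hlead hf
    rw [← hc] at h1
    have h2 := map_mul_eq_zero_of_degree_lt hdeg hlead horth h1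
    have h3 : L (f * P N) / L (P N * P N) = c := by
      rw [mul_sub, map_sub, mul_left_comm, map_C_mul, sub_eq_zero] at h2
      rw [mul_comm f, h2]
      exact mul_div_cancel_right₀ c (hpos N).ne'
    rw [Finset.sum_range_succ, h3]
    have h4 : ∀ k ∈ Finset.range N, C (L (f * P k) / L (P k * P k)) * P k =
        C (L ((f - C c * P N) * P k) / L (P k * P k)) * P k := by
      intro k hk
      have hk' : N ≠ k := (Finset.mem_range.mp hk).ne'
      rw [sub_mul, map_sub, mul_assoc (C c), map_C_mul, horth N k hk', mul_zero, sub_zero]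
    rw [Finset.sum_congr rfl h4, ← ih h1]
    ring

/-- The linearization coefficients of an orthogonal polynomial sequence. -/
theorem isLinearization_iff (hdeg : ∀ n, (P n).natDegree ≤ n)
    (hlead : ∀ n, (P n).coeff n ≠ 0) (horth : ∀ i j, i ≠ j → L (P i * P j) = 0)
    (hpos : ∀ i, 0 < L (P i * P i)) {g : ℕ → ℕ → ℕ → ℝ} :
    IsLinearization P g ↔
      ∀ m n k, g m n k = L (P m * P n * P k) / L (P k * P k) := by
  have vanish : ∀ i j l, i + j < l → L (P l * (P i * P j)) = 0 := by
    intro i j l h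
    apply map_mul_eq_zero_of_degree_lt hdeg hlead horth
    refine lt_of_le_of_lt degree_le_natDegree ?_
    have := natDegree_mul_le (p := P i) (q := P j)
    have := hdeg i
    have := hdeg j
    exact_mod_cast (by omega : (P i * P j).natDegree < l)
  have outside : ∀ m n k : ℕ, k ∉ Finset.Icc ((m : ℤ) - (n : ℤ)).natAbs (m + n) →
      L (P m * P n * P k) = 0 := by
    intro m n k hk
    rw [Finset.mem_Icc] at hk
    -- Outside the summation range one index exceeds the sum of the other two, and its polynomial is
    -- orthogonal to the product of the others.
    rcases (by omega : m + n < k ∨ n + k < m ∨ m + k < n) with h | h | h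
    · rw [mul_comm]; exact vanish _ _ _ h
    · rw [mul_assoc]; exact vanish _ _ _ h
    · rw [mul_comm (P m), mul_assoc]; exact vanish _ _ _ h
  constructor
  · intro hg m n k
    obtain ⟨h1, h2⟩ := hg m n
    by_cases hk : k ∈ Finset.Icc ((m : ℤ) - (n : ℤ)).natAbs (m + n)
    · rw [h1, Finset.sum_mul, map_sum, Finset.sum_eq_single k]
      · rw [mul_assoc, map_C_mul]
        exact (mul_div_cancel_right₀ _ (hpos k).ne').symm
      · intro j _ hj
        rw [mul_assoc, map_C_mul, horth j k hj, mul_zero]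
      · intro h; exact absurd hk h
    · rw [h2 k hk, outside m n k hk, zero_div]
  · intro hg m n
    refine ⟨?_, fun k hk => by rw [hg, outside m n k hk, zero_div]⟩
    have hd : (P m * P n).degree < ((m + n + 1 : ℕ) : WithBot ℕ) := by
      refine lt_of_le_of_lt degree_le_natDegree ?_
      have := natDegree_mul_le (p := P m) (q := P n)
      have := hdeg m
      have := hdeg n
      exact_mod_cast (by omega : (P m * P n).natDegree < m + n + 1)
    have h1 := eq_sum_of_degree_lt hdeg hlead horth hpos hd
    rw [h1]
    have hsub : Finset.Icc ((m : ℤ) - (n : ℤ)).natAbs (m + n) ⊆ Finset.range (m + n + 1) := by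
      intro k hk
      rw [Finset.mem_Icc] at hk
      rw [Finset.mem_range]
      omega
    rw [← Finset.sum_subset hsub]
    · exact Finset.sum_congr rfl fun k _ => by rw [hg]
    · intro k _ hk
      rw [outside m n k hk]; simp

end orthogonal_sequence

/-! ### Orthogonality and positivity of the extreme integrals -/

section orthogonality

variable {α β : ℝ}

theorem leadingCoeff_jacobiY_ne_zero (hα : -1 < α) (hβ : -1 < β) (n : ℕ) :
    jacobiCoeff α β n n ≠ 0 := by
  have h1 := ascPochhammer_eval_neg_nat_ne_zero (le_refl n)
  have h2 := (ascPochhammer_eval_pos n (c := α + 1) (by linarith)).ne'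
  have h4 : (n.factorial : ℝ) ≠ 0 := by positivity
  have h3 : (ascPochhammer ℝ n).eval ((n : ℝ) + α + β + 1) ≠ 0 := by
    cases n with
    | zero => simp
    | succ n =>
      apply (ascPochhammer_eval_pos _ _).ne'
      have : (0:ℝ) ≤ n := n.cast_nonneg
      push_cast; linarith
  exact div_ne_zero (mul_ne_zero h1 h3) (mul_ne_zero h2 h4)

theorem natDegree_jacobiY_le (n : ℕ) : (jacobiY α β n).natDegree ≤ n := by
  rw [natDegree_le_iff_coeff_eq_zero]
  intro k hk
  rw [coeff_jacobiY, jacobiCoeff_eq_zero α β hk]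

/-- Eigenfunctions of a symmetric operator: the eigenvalues differ by (m - n)(m + n + α + β + 1),
and the last factor is positive since m + n ≥ 1. -/
theorem jacobiFunctional_jacobiY_mul_jacobiY (hα : -1 < α) (hβ : -1 < β) {m n : ℕ} (h : m ≠ n) :
    jacobiFunctional α β (jacobiY α β m * jacobiY α β n) = 0 := by
  have s1 := jacobiFunctional_symm hα hβ (jacobiY α β m) (jacobiY α β n)
  have s2 := jacobiFunctional_symm hα hβ (jacobiY α β n) (jacobiY α β m)
  rw [jacobiY_ode hα, neg_mul, map_neg, mul_assoc, jacobiFunctional_C_mul] at s1 s2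
  have e : X * (1 - X) * derivative (jacobiY α β n) * derivative (jacobiY α β m) =
    X * (1 - X) * derivative (jacobiY α β m) * derivative (jacobiY α β n) := by ring
  rw [e, mul_comm (jacobiY α β n)] at s2
  have h3 : ((m : ℝ) - n) * (m + n + α + β + 1) *
      jacobiFunctional α β (jacobiY α β m * jacobiY α β n) = 0 := by
    linear_combination s2 - s1
  have h4 : ((m : ℝ) - n) ≠ 0 := sub_ne_zero.mpr (by exact_mod_cast h)
  have h5 : ((m : ℝ) + n + α + β + 1) ≠ 0 := by
    have : (1 : ℝ) ≤ m + n := by exact_mod_cast (by omega : 1 ≤ m + n)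
    linarith
  simpa [h4, h5] using h3

theorem jacobiFunctional_jacobiY_mul_eq_zero (hα : -1 < α) (hβ : -1 < β) {n : ℕ} {f : ℝ[X]}
    (hf : f.natDegree < n) : jacobiFunctional α β (jacobiY α β n * f) = 0 :=
  map_mul_eq_zero_of_degree_lt natDegree_jacobiY_le
    (fun n => by rw [coeff_jacobiY]; exact leadingCoeff_jacobiY_ne_zero hα hβ n)
    (fun _ _ h => jacobiFunctional_jacobiY_mul_jacobiY hα hβ h)
    (lt_of_le_of_lt degree_le_natDegree (by exact_mod_cast hf))

theorem tripleE_eq_zero (hα : -1 < α) (hβ : -1 < β) {m n k : ℕ} (h : m + n < k) :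
    tripleE α β m n k = 0 := by
  rw [tripleE, mul_comm]
  apply jacobiFunctional_jacobiY_mul_eq_zero hα hβ
  refine lt_of_le_of_lt (natDegree_mul_le) ?_
  have := natDegree_jacobiY_le (α := α) (β := β) m
  have := natDegree_jacobiY_le (α := α) (β := β) n
  omega

theorem tripleO_eq_zero_of_lt (hα : -1 < α) (hβ : -1 < β) {m n k : ℕ} (h : m + k < n) :
    tripleO α β m n k = 0 := by
  have h0 : (2 * n + α + β + 2) ≠ 0 := by
    have : (0:ℝ) ≤ n := n.cast_nonneg
    linarith
  have e : C (2 * n + α + β + 2) *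
      ((1 - X) * (jacobiY α β m * jacobiY α (β + 1) n * jacobiY α (β + 1) k)) =
      C (n + 1 + α) * (jacobiY α β (n + 1) * (jacobiY α β m * jacobiY α (β + 1) k)) +
      C (n + 1 + β) * (jacobiY α β n * (jacobiY α β m * jacobiY α (β + 1) k)) := by
    linear_combination (jacobiY α β m * jacobiY α (β + 1) k) *
      one_sub_X_mul_jacobiY (β := β) hα n
  have hd : (jacobiY α β m * jacobiY α (β + 1) k).natDegree ≤ m + k :=
    natDegree_mul_le.trans
      (add_le_add (natDegree_jacobiY_le (α := α) (β := β) m)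
        (natDegree_jacobiY_le (α := α) (β := β + 1) k))
  apply mul_left_cancel₀ h0
  rw [tripleO, ← jacobiFunctional_C_mul, e, map_add, jacobiFunctional_C_mul,
    jacobiFunctional_C_mul, jacobiFunctional_jacobiY_mul_eq_zero hα hβ (by omega),
    jacobiFunctional_jacobiY_mul_eq_zero hα hβ (by omega)]
  ring

theorem jacobiY_zero : jacobiY α β 0 = 1 := by simp [jacobiY, jacobiCoeff_zero]

theorem pos_of_mul_eq {x y z : ℝ} (h : x * y = z) (hx : 0 < x) (hz : 0 < z) : 0 < y :=
  (mul_pos_iff_of_pos_left hx).mp (h ▸ hz)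

/-- One climb of a ladder E → Z → O → Z → E. At each rung of the extreme integrals, orthogonality
kills one term of the relation and leaves a proportionality with positive factors. -/
theorem tripleO_pos_and_tripleE_pos_of_tripleE_pos (hα : -1 < α) (hβ : -1 < β) {m n : ℕ}
    (h : 0 < tripleE α β m n (m + n)) :
    0 < tripleO α β n m (m + n) ∧ 0 < tripleE α β (m + 1) n (m + n + 1) := by
  have hm : (0:ℝ) ≤ m := m.cast_nonneg
  have hn : (0:ℝ) ≤ n := n.cast_nonneg
  have h1 := tripleZ_eq_tripleE (β := β) hα (m + n) m n
  rw [tripleE_swap α β (m + n + 1), tripleE_swap' α β m (m + n + 1),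
    tripleE_eq_zero hα hβ (by omega : m + n < m + n + 1), tripleE_swap α β (m + n),
    tripleE_swap' α β m (m + n), mul_zero, zero_add] at h1
  push_cast at h1
  have hZ : 0 < tripleZ α β (m + n) m n :=
    pos_of_mul_eq h1 (by linarith) (mul_pos (by linarith) h)
  have hO : 0 < tripleO α β n m (m + n) := by
    -- For m = 0 the factor α + β + 1 may fail to be positive, but the degree-zero polynomial does
    -- not depend on β, so the two integrals coincide.
    rcases Nat.eq_zero_or_pos m with rfl | hm'
    · have e : tripleO α β n 0 (0 + n) = tripleZ α β (0 + n) 0 n := by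
        simp only [tripleO, tripleZ, jacobiY_zero, mul_one]
        rw [mul_comm (jacobiY α β n)]
      rw [e]; exact hZ
    · have h2 := tripleZ_eq_tripleO (α := α) (β := β) (m + n) m n
      rw [tripleO_swap α β n (m - 1), tripleO_eq_zero_of_lt hα hβ
        (by omega : n + (m - 1) < m + n), mul_zero, add_zero] at h2
      have hm1 : (1 : ℝ) ≤ m := by exact_mod_cast hm'
      exact pos_of_mul_eq h2.symm (by linarith) (mul_pos (by linarith) hZ)
  refine ⟨hO, ?_⟩
  have h3 := tripleZ_eq_tripleO (α := α) (β := β) m (m + n + 1) n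
  rw [tripleO_eq_zero_of_lt hα hβ (by omega : n + m < m + n + 1), Nat.add_sub_cancel,
    tripleO_swap α β n (m + n), mul_zero, zero_add] at h3
  have h4 := tripleZ_eq_tripleE (β := β) hα m (m + n + 1) n
  rw [tripleE_swap' α β m, tripleE_eq_zero hα hβ (by omega : m + n < m + n + 1),
    tripleE_swap' α β (m + 1), mul_zero, add_zero] at h4
  push_cast at h3 h4
  have hZ' : 0 < tripleZ α β m (m + n + 1) n :=
    pos_of_mul_eq h3 (by linarith) (mul_pos (by linarith) hO)
  exact pos_of_mul_eq h4.symm (by linarith) (mul_pos (by linarith) hZ')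

theorem tripleE_pos (hα : -1 < α) (hβ : -1 < β) (m n : ℕ) : 0 < tripleE α β m n (m + n) := by
  have h0 : ∀ n, 0 < tripleE α β n 0 (n + 0) := by
    intro n
    induction n with
    | zero => simp [tripleE, jacobiY_zero, jacobiFunctional_one]
    | succ n ih => exact (tripleO_pos_and_tripleE_pos_of_tripleE_pos hα hβ ih).2
  induction m with
  | zero =>
    have := h0 n
    rwa [tripleE_swap, add_comm] at this
  | succ m ih =>
    have := (tripleO_pos_and_tripleE_pos_of_tripleE_pos hα hβ ih).2
    rwa [show m + 1 + n = m + n + 1 by ring]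

theorem tripleO_pos (hα : -1 < α) (hβ : -1 < β) (m n : ℕ) : 0 < tripleO α β n m (m + n) :=
  (tripleO_pos_and_tripleE_pos_of_tripleE_pos hα hβ (tripleE_pos hα hβ m n)).1

end orthogonality

/-! ### Elimination down to a three-term recurrence -/

section contiguous

variable {α β : ℝ}

/-- Eliminating the auxiliary integral and `tripleO α β k m n` leaves a `tripleO` with index sum
lower by one; this drives the induction in `tripleO_nonneg`. -/
theorem tripleO_eq_tripleO_add_tripleE (hα : -1 < α) (hβ : -1 < β) (m n k : ℕ) :
    (k + α + β + 1) * (n + α + β + 1) * (m + n + k + α + β + 2) * tripleO α β m n k =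
      m * (n + α + β + 1) * (m + k - n + α + β) * tripleO α β k (m - 1) n +
      (m + k + α + β + 1) * (n + β + 1) * (n + k - m + α + β + 1) * tripleE α β m n k := by
  linear_combination ((m : ℝ) + k + α + β + 1) * (n + α + β + 1) *
      (tripleO_add_tripleO hα hβ m n k + tripleZ_eq_tripleO (α := α) (β := β) n m k) -
    (tripleO_sub_tripleO hα hβ m n k + ((n : ℝ) + 1) * (n + α + β + 1) *
      tripleZ_eq_tripleO (α := α) (β := β) n m k)

theorem tripleO_eq_tripleZ_add_tripleE (hα : -1 < α) (hβ : -1 < β) (m n k : ℕ) :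
    2 * (n + 1) * (n + α + β + 1) * (m + α + β + 1) * tripleO α β k m n =
      (n + α + β + 1) * (n + k - m + 1) * (m + k - n + α + β) * tripleZ α β n m k +
      (n + β + 1) * ((n + 1) * (n + α + β + 1) + (m - k) * (m + k + α + β + 1)) *
        tripleE α β m n k := by
  linear_combination ((n : ℝ) + 1) * (n + α + β + 1) * tripleO_add_tripleO hα hβ m n k +
    tripleO_sub_tripleO hα hβ m n k

/-- Links two `tripleO` integrals with neighbouring n through a single `tripleE`. At n = j + 1 it
starts the elimination for the three-term recurrence. -/
theorem tripleO_sub_tripleO_pred (hα : -1 < α) (hβ : -1 < β) (m n k : ℕ) :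
    (m + α + β + 1) * ((n + α + β + 1) * (m + n + k + α + β + 2) * (m + n - k + 1) *
        tripleO α β k m n -
      n * (m + k - n + 1) * (n + k - m + α + β) * tripleO α β k m (n - 1)) =
      (2 * n + α + β + 1) * (m + β + 1) *
        ((m + 1) * (m + α + β + 1) + (n - k) * (n + k + α + β + 1)) * tripleE α β m n k := by
  have h1 := tripleO_eq_tripleZ_add_tripleE hα hβ n m k
  have h2 := tripleZ_eq_tripleO (α := α) (β := β) m n k
  rw [tripleO_swap α β k n, tripleE_swap] at h1
  rw [tripleO_swap α β k n, tripleO_swap α β k (n - 1)] at h2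
  linear_combination (2 * (n : ℝ) + α + β + 1) * h1 +
    ((m : ℝ) + α + β + 1) * (m + k - n + 1) * (n + k - m + α + β) * h2

/-- The quadratic polynomial whose sign governs the three-term relation. -/
def middleQuad (a lm ln t : ℝ) : ℝ :=
  3 * t ^ 2 - (2 * (lm + ln) - a + 1) * t - (lm - ln) ^ 2 - (a - 1) * (lm + ln)

/-- Elimination of the auxiliary integrals from the relations at two neighbouring indices. -/
theorem three_term_elimination {x0 x1 x2 p0 p1 y0 y1 t w J J1 Ja Jb c1 c1' c2 c2' r1 r1' r0 α0 α1
    β0 β1 g0 g1 W0 W1 d1 d0 d0' b b' Q : ℝ}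
    (hU : t * (Jb * c1 * c1' * p1 - J * c2 * c2' * p0) = w * x1)
    (e1 : 2 * J1 * Jb * t * p1 = Jb * (r1 * r1') * y1 + β1 * W1 * x1)
    (e0 : 2 * J * Ja * t * p0 = Ja * r0 * y0 + β0 * W0 * x0)
    (z1 : g1 * y1 = α1 * x2 + β1 * x1) (z0 : g0 * y0 = α0 * x1 + β0 * x0)
    (h1 : Jb * (r1 * r1') + g1 * W1 = J1 * d1) (h0 : Ja * r0 + g0 * W0 = J * (d0 * d0'))
    (hB : g0 * (c1 * c1') * β1 * d1 - g1 * (c2 * c2') * r0 * α0 - 2 * g1 * g0 * w = b * b' * Q) :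
    Ja * Jb * c1 * c1' * r1 * r1' * α1 * g0 * x2 + b * b' * J1 * Ja * Q * x1 =
      J * J1 * c2 * c2' * d0 * d0' * β0 * g1 * x0 := by
  linear_combination g1 * g0 * (2 * J1 * Ja * hU - Ja * c1 * c1' * e1 + J1 * c2 * c2' * e0) -
    g0 * Ja * c1 * c1' * Jb * r1 * r1' * z1 + g1 * J1 * c2 * c2' * Ja * r0 * z0 -
    g0 * Ja * c1 * c1' * β1 * x1 * h1 + g1 * J1 * c2 * c2' * β0 * x0 * h0 - J1 * Ja * x1 * hB

/-- The three-term relation of the linearization coefficients of Jacobi polynomials. -/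
theorem tripleE_three_term (hα : -1 < α) (hβ : -1 < β) {a b : ℝ} (ha : a = α + β + 1)
    (hb : b = α - β) (m n j : ℕ) {J : ℝ} (hJ : J = j + 1) :
    (J + a - 1) * (J + a) * (m + n + J + a + 1) * (m + J - n + 1) * (J + n - m + 1) *
        (m + n - J + a - 1) * (J + 1 + α) * (2 * J + a - 1) * tripleE α β m n (j + 2) +
      b * (2 * J + a) * (J + 1) * (J + a - 1) *
        middleQuad a (m * (m + a)) (n * (n + a)) (J * (J + a)) * tripleE α β m n (j + 1) =
      J * (J + 1) * (m + n - J + 1) * (J + n - m + a - 1) * (J + m - n + a - 1) *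
        (m + n + J + 2 * a - 1) * (J + β) * (2 * J + a + 1) * tripleE α β m n j := by
  have hU := tripleO_sub_tripleO_pred hα hβ m (j + 1) n
  have e1 := tripleO_eq_tripleZ_add_tripleE hα hβ m (j + 1) n
  have e2 := tripleO_eq_tripleZ_add_tripleE hα hβ m j n
  have z1 := tripleZ_eq_tripleE (β := β) hα (j + 1) m n
  have z2 := tripleZ_eq_tripleE (β := β) hα j m n
  rw [Nat.add_sub_cancel] at hU
  rw [tripleE_swap' α β m (j + 1)] at hU e1
  rw [tripleE_swap' α β m j] at e2
  rw [tripleE_swap α β (j + 1 + 1) m, tripleE_swap' α β m (j + 1 + 1),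
    tripleE_swap α β (j + 1) m, tripleE_swap' α β m (j + 1)] at z1
  rw [tripleE_swap α β (j + 1) m, tripleE_swap' α β m (j + 1),
    tripleE_swap α β j m, tripleE_swap' α β m j] at z2
  push_cast at hU e1 e2 z1 z2
  have hα' : α = (a - 1 + b) / 2 := by rw [ha, hb]; ring
  have hβ' : β = (a - 1 - b) / 2 := by rw [ha, hb]; ring
  have hj : (j : ℝ) = J - 1 := by rw [hJ]; ring
  rw [show j + 1 + 1 = j + 2 from rfl] at z1
  rw [← hJ] at hU e1 z1
  clear ha hb hJ
  generalize tripleE α β m n (j + 2) = x2 at *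
  generalize tripleE α β m n (j + 1) = x1 at *
  generalize tripleE α β m n j = x0 at *
  generalize tripleO α β n m (j + 1) = p1 at *
  generalize tripleO α β n m j = p0 at *
  generalize tripleZ α β (j + 1) m n = y1 at *
  generalize tripleZ α β j m n = y0 at *
  rw [hj] at e2 z2
  generalize (m : ℝ) = M at *
  generalize (n : ℝ) = N at *
  subst hα' hβ'
  -- The last three side goals are polynomial identities: two collapse the outer coefficients into
  -- products, and the third extracts b (2J + a) times the quadratic from the middle one.
  refine three_term_elimination (p0 := p0) (p1 := p1) (y0 := y0) (y1 := y1) (t := M + a)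
    (w := (2 * J + a) * (M + (a - 1 - b) / 2 + 1) *
      ((M + 1) * (M + a) + (J - N) * (J + N + a)))
    (r0 := (J + N - M) * (M + N - J + a)) (α0 := J + (a - 1 + b) / 2)
    (β1 := J + 1 + (a - 1 - b) / 2)
    (W0 := J * (J - 1 + a) + (M - N) * (M + N + a))
    (W1 := (J + 1) * (J + a) + (M - N) * (M + N + a))
    (d1 := (M + N + J + 2 * a) * (J + M - N + a)) ?_ ?_ ?_ ?_ ?_ ?_ ?_ ?_
  · linear_combination hU
  · linear_combination e1
  · linear_combination e2
  · linear_combination z1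
  · linear_combination z2
  · ring
  · ring
  · rw [middleQuad]; ring

end contiguous

/-! ### Sign propagation and the governing quadratic -/

section three_term_sign

/-- A solution of a three-term relation whose middle coefficient changes sign at most once, from
nonpositive to positive, is nonnegative if its first two and last two values are. -/
theorem nonneg_of_three_term {e A B C : ℕ → ℝ} {s t : ℕ}
    (hrec : ∀ i, s ≤ i → i + 2 ≤ t → A i * e (i + 2) + B i * e (i + 1) = C i * e i)
    (hA : ∀ i, s ≤ i → i + 2 ≤ t → 0 < A i) (hC : ∀ i, s ≤ i → i + 2 ≤ t → 0 < C i)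
    (hB : ∀ i j, s ≤ i → i ≤ j → j + 2 ≤ t → B j ≤ 0 → B i ≤ 0)
    (hs : 0 ≤ e s) (hs' : 0 ≤ e (s + 1)) (ht : ∀ i, i + 1 = t → 0 ≤ e i) (ht' : 0 ≤ e t)
    {i : ℕ} (hsi : s ≤ i) (hit : i ≤ t) : 0 ≤ e i := by
  -- Where the middle coefficient is nonpositive the recurrence propagates nonnegativity forwards;
  -- where it is nonnegative, `down` propagates it backwards from the top.
  have up : ∀ k, s + k + 1 ≤ t → (∀ i, s ≤ i → i + 1 ≤ s + k → B i ≤ 0) →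
      0 ≤ e (s + k) ∧ 0 ≤ e (s + k + 1) := by
    intro k
    induction k with
    | zero => intro _ _; exact ⟨hs, hs'⟩
    | succ k ih =>
      intro hk hBk
      obtain ⟨h1, h2⟩ := ih (by omega) (fun i hi hi' => hBk i hi (by omega))
      refine ⟨h2, ?_⟩
      have hr := hrec (s + k) (by omega) (by omega)
      have a1 := hA (s + k) (by omega) (by omega)
      have c1 := hC (s + k) (by omega) (by omega)
      have b1 := hBk (s + k) (by omega) (by omega)
      rw [show s + (k + 1) + 1 = s + k + 2 by ring]
      have h3 : 0 ≤ A (s + k) * e (s + k + 2) := by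
        have := mul_nonneg c1.le h1
        have := mul_nonneg (neg_nonneg.mpr b1) h2
        linarith
      exact nonneg_of_mul_nonneg_right h3 a1
  have down : ∀ k i, i + k + 1 = t → s ≤ i → (∀ j, i ≤ j → j + 2 ≤ t → 0 ≤ B j) →
      0 ≤ e i ∧ 0 ≤ e (i + 1) := by
    intro k
    induction k with
    | zero =>
      intro i hi _ _
      have : i + 1 = t := by omega
      exact ⟨ht i this, this ▸ ht'⟩
    | succ k ih =>
      intro i hi hsi hBi
      obtain ⟨h1, h2⟩ := ih (i + 1) (by omega) (by omega) (fun j hj hj' => hBi j (by omega) hj')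
      refine ⟨?_, h1⟩
      have hr := hrec i (by omega) (by omega)
      have a1 := hA i (by omega) (by omega)
      have c1 := hC i (by omega) (by omega)
      have b1 := hBi i (by omega) (by omega)
      have h3 : 0 ≤ C i * e i := by
        rw [← hr]
        exact add_nonneg (mul_nonneg a1.le h2) (mul_nonneg b1 h1)
      exact nonneg_of_mul_nonneg_right h3 c1
  rcases Nat.lt_or_ge i (s + 2) with h | h
  · rcases (by omega : i = s ∨ i = s + 1) with rfl | rfl
    · exact hs
    · exact hs'
  · rcases eq_or_lt_of_le hit with rfl | h'
    · exact ht'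
    · obtain ⟨k, rfl⟩ := Nat.exists_eq_add_of_le h
      rcases le_or_gt (B (s + k)) 0 with hb | hb
      · have := (up (k + 1) (by omega) (fun i hi hi' =>
          hB i (s + k) hi (by omega) (by omega) hb)).2
        rwa [show s + (k + 1) + 1 = s + 2 + k by ring] at this
      · refine (down (t - (s + 2 + k) - 1) (s + 2 + k) (by omega) (by omega) ?_).1
        intro j hj hj'
        by_contra hneg
        exact absurd (hB (s + k) j (by omega) (by omega) hj' (not_le.mp hneg).le) (not_le.mpr hb)

/-- Convexity in t: a quadratic with leading coefficient 3 lies below its chords. -/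
theorem middleQuad_nonpos_of_le {a lm ln t₀ t₁ t₂ : ℝ} (h01 : t₀ ≤ t₁) (h12 : t₁ ≤ t₂)
    (h0 : middleQuad a lm ln t₀ ≤ 0) (h2 : middleQuad a lm ln t₂ ≤ 0) :
    middleQuad a lm ln t₁ ≤ 0 := by
  rcases eq_or_lt_of_le (h01.trans h12) with h | h
  · have : t₁ = t₀ := le_antisymm (by linarith) h01
    rwa [this]
  · have key : (t₂ - t₀) * middleQuad a lm ln t₁ =
        (t₂ - t₁) * middleQuad a lm ln t₀ + (t₁ - t₀) * middleQuad a lm ln t₂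
        - 3 * ((t₁ - t₀) * (t₂ - t₁) * (t₂ - t₀)) := by
      simp only [middleQuad]; ring
    have h3 : (t₂ - t₀) * middleQuad a lm ln t₁ ≤ 0 := by
      rw [key]
      have := mul_nonneg (mul_nonneg (sub_nonneg.mpr h01) (sub_nonneg.mpr h12))
        (sub_nonneg.mpr h.le)
      have := mul_nonneg (sub_nonneg.mpr h12) (neg_nonneg.mpr h0)
      have := mul_nonneg (sub_nonneg.mpr h01) (neg_nonneg.mpr h2)
      linarith
    by_contra hc
    have := mul_pos (sub_pos.mpr h) (not_le.mp hc)
    linarith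

/-- At the lowest index d = n - m the quadratic factors. The only factor of doubtful sign equals 3(1
+ a)/2 at d = 1. -/
theorem middleQuad_sub_nonpos {a : ℝ} (ha : -1 < a) {m d : ℝ} (hm : 0 ≤ m) (hd : 1 ≤ d) :
    middleQuad a (m * (m + a)) ((m + d) * (m + d + a)) (d * (d + a)) ≤ 0 := by
  have e : middleQuad a (m * (m + a)) ((m + d) * (m + d + a)) (d * (d + a)) =
      - ((2 * d ^ 2 + a * d + (a - 1) / 2) * (4 * (m * (m + d + a)))) := by
    simp only [middleQuad]; ring
  rw [e, neg_nonpos]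
  have h1 : 0 ≤ 2 * d ^ 2 + a * d + (a - 1) / 2 := by nlinarith
  have h2 : 0 ≤ m * (m + d + a) := mul_nonneg hm (by linarith)
  positivity

/-- For equal indices the lowest argument is taken at J = 1. At n = 1 the value is -2a(1 + a), so a
> 0 or a larger n is needed; the bound on a keeps 1 + 3a positive. -/
theorem middleQuad_diag_nonpos {a n : ℝ} (ha : -(31 / 100) ≤ a) (hn : 1 ≤ n)
    (h : 0 < a ∨ 3 ≤ n) :
    middleQuad a (n * (n + a)) (n * (n + a)) (1 * (1 + a)) ≤ 0 := by
  have e : middleQuad a (n * (n + a)) (n * (n + a)) (1 * (1 + a)) =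
      (1 + a) * (2 + 4 * a) - 2 * (n * (n + a)) * (1 + 3 * a) := by
    simp only [middleQuad]; ring
  rw [e]
  rcases h with h | h
  · have h1 : 1 + a ≤ n * (n + a) := by nlinarith
    nlinarith [mul_le_mul_of_nonneg_right h1 (by linarith : 0 ≤ 1 + 3 * a)]
  · rcases le_or_gt a 0 with h0 | h0
    · have h1 : 9 + 3 * a ≤ n * (n + a) := by nlinarith
      nlinarith [mul_le_mul_of_nonneg_right h1 (by linarith : 0 ≤ 1 + 3 * a)]
    · have h1 : 1 + a ≤ n * (n + a) := by nlinarith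
      nlinarith [mul_le_mul_of_nonneg_right h1 (by linarith : 0 ≤ 1 + 3 * a)]

end three_term_sign

/-! ### Inequalities on Gasper's set -/

section gasper_set

/-- The condition b < a + 1 is β > -1. On the line b = a + 1 the inequality fails at a = -0.31 and
holds at a = -0.30, so -31/100 is slightly below the smallest possible a, and still above -1/3. -/
theorem neg_le_of_gasper {a b : ℝ} (ha : -1 < a) (hb0 : 0 ≤ b) (hb1 : b < a + 1)
    (hV : (a ^ 2 - 7 * a - 24) * b ^ 2 ≤ a * (a + 5) * (a + 3) ^ 2) : -(31 / 100) ≤ a := by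
  by_contra hc
  push Not at hc
  have h1 : b ^ 2 ≤ (a + 1) ^ 2 := by nlinarith
  have h2 : (24 + 7 * a - a ^ 2) * b ^ 2 ≤ (24 + 7 * a - a ^ 2) * (a + 1) ^ 2 :=
    mul_le_mul_of_nonneg_left h1 (by nlinarith)
  have h3 : 0 ≤ (-a - 31 / 100) * (1 + a) := mul_nonneg (by linarith) (by linarith)
  have h4 : (31 / 100 : ℝ) ^ 3 ≤ (-a) ^ 3 := pow_le_pow_left₀ (by norm_num) (by linarith) 3
  nlinarith

/-- The factor of the third coefficient from the top that decides its sign. -/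
def topFactor (a b m n : ℝ) : ℝ :=
  a * ((2 * m + a - 1) * (2 * n + a - 1) * (2 * (m + n) + a - 3)) +
    b ^ 2 * (8 * (m * n) * (m + n + a - 1) - 2 * (2 * (m + n) + a - 2) ^ 2 + a * (a - 1))

theorem topFactor_two_two (a b : ℝ) :
    topFactor a b 2 2 = a * (a + 5) * (a + 3) ^ 2 - (a ^ 2 - 7 * a - 24) * b ^ 2 := by
  rw [topFactor]; ring

/-- The factor is affine in b². Eliminating b² between the pairs (m, n) and (2, 2) leaves s D, where
s = -a and D is free of b. In the shifts i = m - 2 and j = n - 2, both D and the multiplier z have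
nonnegative coefficients, since 0 ≤ s ≤ 31/100. -/
theorem topFactor_nonneg {a b : ℝ} (ha : -(31 / 100) ≤ a) (ha0 : a ≤ 0)
    (hV : 0 ≤ topFactor a b 2 2) {m n : ℝ} (hm : 2 ≤ m) (hn : 2 ≤ n) :
    0 ≤ topFactor a b m n := by
  obtain ⟨i, rfl⟩ : ∃ i, m = 2 + i := ⟨m - 2, by ring⟩
  obtain ⟨j, rfl⟩ : ∃ j, n = 2 + j := ⟨n - 2, by ring⟩
  obtain ⟨s, rfl⟩ : ∃ s, a = -s := ⟨-a, by ring⟩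
  have hi : 0 ≤ i := by linarith
  have hj : 0 ≤ j := by linarith
  have hs : 0 ≤ s := by linarith
  have hs' : s ≤ 31 / 100 := by linarith
  have hs2 : s ^ 2 ≤ 31 / 100 * s := by nlinarith
  have hs3 : 0 ≤ s ^ 3 := by positivity
  have hs3' : s ^ 3 ≤ 31 / 100 * s ^ 2 := by nlinarith [sq_nonneg s]
  have hs4 : 0 ≤ s ^ 4 := by positivity
  have c1 : 0 ≤ 288 - 600 * s + 420 * s ^ 2 - 120 * s ^ 3 + 12 * s ^ 4 := by nlinarith
  have c2 : 0 ≤ 72 - 132 * s + 72 * s ^ 2 - 12 * s ^ 3 := by nlinarith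
  have c3 : 0 ≤ 744 - 1324 * s + 712 * s ^ 2 - 140 * s ^ 3 + 8 * s ^ 4 := by nlinarith
  have c4 : 0 ≤ 168 - 256 * s + 96 * s ^ 2 - 8 * s ^ 3 := by nlinarith
  have z0 : 0 < 24 - 7 * s - s ^ 2 := by nlinarith
  have z1 : 0 ≤ 32 - 8 * s := by linarith
  have z2 : 0 ≤ 40 - 8 * s := by linarith
  set z := (24 - 7 * s - s ^ 2) + (32 - 8 * s) * (i + j) + 8 * (i ^ 2 + j ^ 2) +
    (40 - 8 * s) * (i * j) + 8 * (i * j * (i + j)) with hz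
  have hz0 : 0 ≤ z := by positivity
  set D := (288 - 600 * s + 420 * s ^ 2 - 120 * s ^ 3 + 12 * s ^ 4) * (i + j) +
    (72 - 132 * s + 72 * s ^ 2 - 12 * s ^ 3) * (i ^ 2 + j ^ 2) +
    (744 - 1324 * s + 712 * s ^ 2 - 140 * s ^ 3 + 8 * s ^ 4) * (i * j) +
    (168 - 256 * s + 96 * s ^ 2 - 8 * s ^ 3) * (i * j * (i + j)) with hD
  have hD0 : 0 ≤ D := by positivity
  have key : (24 - 7 * s - s ^ 2) * topFactor (-s) b (2 + i) (2 + j) =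
      z * topFactor (-s) b 2 2 + s * D := by
    simp only [topFactor, hz, hD]; ring
  have h : 0 ≤ (24 - 7 * s - s ^ 2) * topFactor (-s) b (2 + i) (2 + j) := by
    rw [key]; positivity
  exact nonneg_of_mul_nonneg_right h z0

theorem topFactor_mul_sq (a b m n : ℝ) :
    (2 * (m + n) + a - 1) ^ 2 * topFactor a b m n =
      a * ((2 * m + a - 1) * (2 * n + a - 1) * (2 * (m + n) + a - 3)) *
        ((2 * (m + n) + a - 1) ^ 2 - b ^ 2) +
      2 * b ^ 2 * (2 * (m + n) + a - 2) *
        middleQuad a (m * (m + a)) (n * (n + a)) ((m + n - 1) * (m + n - 1 + a)) := by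
  rw [topFactor, middleQuad]; ring

end gasper_set

/-! ### The second and third integrals from the top -/

section top_coefficients

variable {α β a b : ℝ}

theorem tripleE_top_pred (hα : -1 < α) (hβ : -1 < β) (ha : a = α + β + 1) (hb : b = α - β)
    {m n j : ℕ} (hm : 1 ≤ m) (hn : 1 ≤ n) (hj : m + n = j + 1) :
    (m + n) * ((2 * m + a - 1) * (2 * n + a - 1)) * (m + n + β) * tripleE α β m n j =
      2 * b * (2 * (m + n) + a) * (m + n + a - 1) * (m * n) * tripleE α β m n (m + n) := by
  have hJ : (m : ℝ) + n = j + 1 := by exact_mod_cast hj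
  -- Centred at the top index m + n, the recurrence has a vanishing upper term and becomes a
  -- two-term relation.
  have h := tripleE_three_term hα hβ ha hb m n j hJ
  rw [tripleE_eq_zero hα hβ (by omega : m + n < j + 2), ← hj] at h
  have hm' : (1 : ℝ) ≤ m := by exact_mod_cast hm
  have hn' : (1 : ℝ) ≤ n := by exact_mod_cast hn
  have e : middleQuad a (m * (m + a)) (n * (n + a)) ((m + n) * (m + n + a)) =
      2 * (m * n) * (2 * (m + n) + a + 1) * (2 * (m + n) + 2 * a - 1) := by
    simp only [middleQuad]; ring
  rw [e] at h
  have h1 : ((m : ℝ) + n + 1) * (2 * (m + n) + 2 * a - 1) * (2 * (m + n) + a + 1) ≠ 0 := by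
    have : 0 < (m : ℝ) + n + 1 := by linarith
    have : 0 < 2 * ((m : ℝ) + n) + 2 * a - 1 := by linarith
    have : 0 < 2 * ((m : ℝ) + n) + a + 1 := by linarith
    positivity
  apply mul_left_cancel₀ h1
  linear_combination -h

theorem top_elimination {x0 x1 x2 F1 F2 F3 F8 G S y1 y2 Sα Sβ a b m n U T Q H H' H7 : ℝ}
    (h : F1 * F2 * F3 * (2 * m) * (2 * n) * a * Sα * F8 * x2 + b * G * S * F1 * Q * x1 =
      (S - 1) * S * 2 * H * H' * (2 * F2) * H7 * U * x0)
    (h' : S * (y1 * y2) * Sβ * x1 = 2 * b * F3 * F2 * (m * n) * x2)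
    (hT : U ^ 2 * T = a * (y1 * y2 * F8) * (U ^ 2 - b ^ 2) + 2 * b ^ 2 * G * Q)
    (hS : 4 * (Sα * Sβ) = U ^ 2 - b ^ 2) (hF : F2 * U ≠ 0) :
    4 * (S - 1) * S * H * H' * H7 * (y1 * y2) * Sβ * x0 = F1 * F3 * (m * n) * U * T * x2 := by
  apply mul_left_cancel₀ hF
  linear_combination -(y1 * y2 * Sβ) * h + b * G * F1 * Q * h' - F1 * F3 * (m * n) * F2 * x2 * hT +
    F1 * F2 * F3 * (m * n) * a * (y1 * y2) * F8 * x2 * hS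

theorem tripleE_top_pred_pred (hα : -1 < α) (hβ : -1 < β) (ha : a = α + β + 1) (hb : b = α - β)
    {m n j : ℕ} (hm : 2 ≤ m) (hn : 2 ≤ n) (hj : m + n = j + 2) :
    4 * (m + n - 1) * (m + n) * (2 * n + a - 2) * (2 * m + a - 2) * (m + n - 1 + β) *
        ((2 * m + a - 1) * (2 * n + a - 1)) * (m + n + β) * tripleE α β m n j =
      (m + n + a - 2) * (2 * (m + n) + a) * (m * n) * (2 * (m + n) + a - 1) *
        topFactor a b m n * tripleE α β m n (m + n) := by
  have hJ : (m : ℝ) + n = j + 2 := by exact_mod_cast hj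
  have h := tripleE_three_term hα hβ ha hb m n j (J := m + n - 1) (by linarith)
  have h' := tripleE_top_pred hα hβ ha hb (by omega : 1 ≤ m) (by omega : 1 ≤ n)
    (by omega : m + n = j + 1 + 1)
  rw [← hj] at h
  have hm' : (2 : ℝ) ≤ m := by exact_mod_cast hm
  have hn' : (2 : ℝ) ≤ n := by exact_mod_cast hn
  have h1 : ((m : ℝ) + n + a - 1) * (2 * (m + n) + a - 1) ≠ 0 := by
    have : 0 < (m : ℝ) + n + a - 1 := by linarith
    have : 0 < 2 * ((m : ℝ) + n) + a - 1 := by linarith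
    positivity
  have hα' : α = (a - 1 + b) / 2 := by rw [ha, hb]; ring
  have hβ' : β = (a - 1 - b) / 2 := by rw [ha, hb]; ring
  clear hJ ha hb
  generalize tripleE α β m n (m + n) = x2 at *
  generalize tripleE α β m n (j + 1) = x1 at *
  generalize tripleE α β m n j = x0 at *
  generalize (m : ℝ) = M at *
  generalize (n : ℝ) = N at *
  subst hα' hβ'
  have hT := topFactor_mul_sq a b M N
  generalize topFactor a b M N = T at *
  generalize middleQuad a (M * (M + a)) (N * (N + a)) ((M + N - 1) * (M + N - 1 + a)) = Q at *
  rw [show M + N - 1 + a - 1 = M + N + a - 2 by ring, show M + N - 1 + a = M + N + a - 1 by ring,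
    show M + N + (M + N - 1) + a + 1 = 2 * (M + N) + a by ring,
    show M + (M + N - 1) - N + 1 = 2 * M by ring, show M + N - 1 + N - M + 1 = 2 * N by ring,
    show M + N - (M + N - 1) + a - 1 = a by ring,
    show 2 * (M + N - 1) + a - 1 = 2 * (M + N) + a - 3 by ring,
    show 2 * (M + N - 1) + a = 2 * (M + N) + a - 2 by ring,
    show 2 * (M + N) + a - 2 + 1 = 2 * (M + N) + a - 1 by ring,
    show M + N - (M + N - 1) + 1 = 2 by ring,
    show M + N - 1 + N - M + a - 1 = 2 * N + a - 2 by ring,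
    show M + N - 1 + M - N + a - 1 = 2 * M + a - 2 by ring,
    show M + N + (M + N - 1) + 2 * a - 1 = 2 * (M + N + a - 1) by ring,
    show M + N - 1 + 1 = M + N by ring] at h
  exact top_elimination h h' hT (by ring) h1

end top_coefficients

/-! ### Nonnegativity for three even indices -/

section tripleE_nonneg

variable {α β a b : ℝ}

theorem tripleE_top_pred_nonneg (hα : -1 < α) (hβ : -1 < β) (ha : a = α + β + 1)
    (hb : b = α - β) (hb0 : 0 ≤ b) {m n j : ℕ} (hm : 1 ≤ m) (hn : 1 ≤ n) (hj : m + n = j + 1) :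
    0 ≤ tripleE α β m n j := by
  have h := tripleE_top_pred hα hβ ha hb hm hn hj
  have hm' : (1 : ℝ) ≤ m := by exact_mod_cast hm
  have hn' : (1 : ℝ) ≤ n := by exact_mod_cast hn
  have p0 := tripleE_pos hα hβ m n
  have p1 : 0 < 2 * (m : ℝ) + a - 1 := by linarith
  have p2 : 0 < 2 * (n : ℝ) + a - 1 := by linarith
  have p3 : 0 < (m : ℝ) + n + β := by linarith
  have p4 : 0 < 2 * ((m : ℝ) + n) + a := by linarith
  have p5 : 0 < (m : ℝ) + n + a - 1 := by linarith
  have p6 : 0 < (m : ℝ) + n := by linarith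
  refine nonneg_of_mul_nonneg_right (b := tripleE α β m n j) (by rw [h]; positivity) ?_
  positivity

theorem nonneg_of_tripleE_one_nonneg (hα : -1 < α) (hβ : -1 < β) (ha : a = α + β + 1)
    (hb : b = α - β) (h0 : 0 ≤ tripleE α β 1 1 1) : 0 ≤ b := by
  have h := tripleE_top_pred hα hβ ha hb (m := 1) (n := 1) (j := 1) le_rfl le_rfl rfl
  have p0 := tripleE_pos hα hβ 1 1
  push_cast at h
  have p1 : 0 < 1 + a := by linarith
  have p2 : 0 < 2 + β := by linarith
  have p3 : 0 < 4 + a := by linarith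
  have h1 : 0 ≤ b * ((4 + a) * (1 + a) * tripleE α β 1 1 (1 + 1)) := by
    have : b * ((4 + a) * (1 + a) * tripleE α β 1 1 (1 + 1)) =
      (1 + a) * (1 + a) * (2 + β) * tripleE α β 1 1 1 := by linear_combination -h / 2
    rw [this]; positivity
  exact nonneg_of_mul_nonneg_left h1 (by positivity)

theorem tripleE_top_pred_pred_nonneg_iff (hα : -1 < α) (hβ : -1 < β) (ha : a = α + β + 1)
    (hb : b = α - β) {m n j : ℕ} (hm : 2 ≤ m) (hn : 2 ≤ n) (hj : m + n = j + 2) :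
    0 ≤ tripleE α β m n j ↔ 0 ≤ topFactor a b m n := by
  have h := tripleE_top_pred_pred hα hβ ha hb hm hn hj
  have hm' : (2 : ℝ) ≤ m := by exact_mod_cast hm
  have hn' : (2 : ℝ) ≤ n := by exact_mod_cast hn
  have p0 := tripleE_pos hα hβ m n
  have p1 : 0 < 2 * (m : ℝ) + a - 1 := by linarith
  have p2 : 0 < 2 * (n : ℝ) + a - 1 := by linarith
  have p1' : 0 < 2 * (m : ℝ) + a - 2 := by linarith
  have p2' : 0 < 2 * (n : ℝ) + a - 2 := by linarith
  have p3 : 0 < (m : ℝ) + n + β := by linarith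
  have p3' : 0 < (m : ℝ) + n - 1 + β := by linarith
  have p4 : 0 < 2 * ((m : ℝ) + n) + a := by linarith
  have p4' : 0 < 2 * ((m : ℝ) + n) + a - 1 := by linarith
  have p5 : 0 < (m : ℝ) + n + a - 2 := by linarith
  have p6 : 0 < (m : ℝ) + n := by linarith
  have p7 : 0 < (m : ℝ) + n - 1 := by linarith
  have p8 : 0 < (m : ℝ) := by linarith
  have p9 : 0 < (n : ℝ) := by linarith
  have e1 : 0 < 4 * ((m : ℝ) + n - 1) * (m + n) * (2 * n + a - 2) * (2 * m + a - 2) *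
    (m + n - 1 + β) * ((2 * m + a - 1) * (2 * n + a - 1)) * (m + n + β) := by positivity
  have e2 : 0 < ((m : ℝ) + n + a - 2) * (2 * (m + n) + a) * (m * n) * (2 * (m + n) + a - 1) *
    tripleE α β m n (m + n) := by positivity
  constructor
  · intro h1
    have : 0 ≤ (((m : ℝ) + n + a - 2) * (2 * (m + n) + a) * (m * n) * (2 * (m + n) + a - 1) *
        tripleE α β m n (m + n)) * topFactor a b m n := by
      have := mul_nonneg e1.le h1
      rw [h] at this
      linarith
    exact nonneg_of_mul_nonneg_right this e2
  · intro h1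
    refine nonneg_of_mul_nonneg_right (b := tripleE α β m n j) ?_ e1
    rw [h]
    have := mul_nonneg e2.le h1
    linarith

/-- Nonnegativity on an interval of indices follows from nonnegativity near its ends. -/
theorem tripleE_nonneg_of_ends (hα : -1 < α) (hβ : -1 < β) (ha : a = α + β + 1)
    (hb : b = α - β) (hb0 : 0 ≤ b) {m d s t : ℕ} (hm : 1 ≤ m) (hds : d ≤ s)
    (hsa : (1 : ℝ) < s + 1 - d + a) (ht : t ≤ m + (m + d))
    (hta : (2 : ℝ) < m + (m + d) - t + 2 + a)
    (hquad : d = 0 → middleQuad a (m * (m + a)) (m * (m + a)) (1 * (1 + a)) ≤ 0)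
    (h1 : 0 ≤ tripleE α β m (m + d) s) (h2 : 0 ≤ tripleE α β m (m + d) (s + 1))
    (h3 : ∀ i, i + 1 = t → 0 ≤ tripleE α β m (m + d) i) (h4 : 0 ≤ tripleE α β m (m + d) t)
    {i : ℕ} (hsi : s ≤ i) (hit : i ≤ t) : 0 ≤ tripleE α β m (m + d) i := by
  have hm' : (1 : ℝ) ≤ m := by exact_mod_cast hm
  have hd' : (0 : ℝ) ≤ d := d.cast_nonneg
  have ha1 : -1 < a := by linarith
  have hα' : α = (a - 1 + b) / 2 := by rw [ha, hb]; ring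
  have hβ' : β = (a - 1 - b) / 2 := by rw [ha, hb]; ring
  set n := m + d with hn
  have hn' : (n : ℝ) = m + d := by rw [hn]; push_cast; ring
  have hbase : ∀ i : ℕ, s ≤ i → i + 2 ≤ t → (1 : ℝ) ≤ i + 1 - d ∧ (0 : ℝ) < i + 1 - d + a - 1 ∧
      (i : ℝ) + 2 ≤ m + n ∧ (0 : ℝ) < m + n - (i + 1) + a - 1 := by
    intro i hi hi'
    have e1 : (s : ℝ) ≤ i := by exact_mod_cast hi
    have e2 : (i : ℝ) + 2 ≤ t := by exact_mod_cast hi'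
    have e3 : (d : ℝ) ≤ s := by exact_mod_cast hds
    have e4 : (t : ℝ) ≤ m + (m + d) := by exact_mod_cast ht
    rw [hn']
    refine ⟨by linarith, by linarith, by linarith, by linarith⟩
  refine nonneg_of_three_term (e := fun i => tripleE α β m n i)
    (A := fun i : ℕ => ((i : ℝ) + 1 + a - 1) * (i + 1 + a) * (m + n + (i + 1) + a + 1) *
      (m + (i + 1) - n + 1) * (i + 1 + n - m + 1) *
        (m + n - (i + 1) + a - 1) * (i + 1 + 1 + α) * (2 * (i + 1) + a - 1))
    (B := fun i : ℕ => b * (2 * ((i : ℝ) + 1) + a) * (i + 1 + 1) * (i + 1 + a - 1) *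
        middleQuad a (m * (m + a)) (n * (n + a)) ((i + 1) * (i + 1 + a)))
    (C := fun i : ℕ => ((i : ℝ) + 1) * (i + 1 + 1) * (m + n - (i + 1) + 1) *
      (i + 1 + n - m + a - 1) * (i + 1 + m - n + a - 1) *
        (m + n + (i + 1) + 2 * a - 1) * (i + 1 + β) * (2 * (i + 1) + a + 1))
    (fun i _ _ => tripleE_three_term hα hβ ha hb m n i rfl) ?_ ?_ ?_ h1 h2 h3 h4 hsi hit
  · intro i hi hi'
    obtain ⟨f1, f2, f3, f4⟩ := hbase i hi hi'
    have g1 : 0 < (i : ℝ) + 1 + a - 1 := by linarith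
    have g2 : 0 < (i : ℝ) + 1 + a := by linarith
    have g3 : 0 < (m : ℝ) + n + (i + 1) + a + 1 := by linarith
    have g4 : 0 < (m : ℝ) + (i + 1) - n + 1 := by linarith
    have g5 : 0 < (i : ℝ) + 1 + n - m + 1 := by linarith
    have g6 : 0 < (i : ℝ) + 1 + 1 + α := by linarith
    have g7 : 0 < 2 * ((i : ℝ) + 1) + a - 1 := by linarith
    positivity
  · intro i hi hi'
    obtain ⟨f1, f2, f3, f4⟩ := hbase i hi hi'
    have g3 : 0 < (m : ℝ) + n - (i + 1) + 1 := by linarith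
    have g4 : 0 < (i : ℝ) + 1 + n - m + a - 1 := by linarith
    have g5 : 0 < (i : ℝ) + 1 + m - n + a - 1 := by linarith
    have g6 : 0 < (m : ℝ) + n + (i + 1) + 2 * a - 1 := by linarith
    have g7 : 0 < (i : ℝ) + 1 + β := by linarith
    have g8 : 0 < 2 * ((i : ℝ) + 1) + a + 1 := by linarith
    positivity
  · intro i j hi hij hj hBj
    obtain ⟨f1, f2, f3, f4⟩ := hbase i hi (by omega)
    obtain ⟨f1', f2', f3', f4'⟩ := hbase j (by omega) hj
    have hij' : (i : ℝ) ≤ j := by exact_mod_cast hij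
    -- If b = 0 every middle coefficient vanishes; otherwise its sign is that of the quadratic.
    rcases eq_or_lt_of_le hb0 with hb1 | hb1
    · simp [← hb1]
    · have k1 : 0 < (i : ℝ) + 1 + a - 1 := by linarith
      have k2 : 0 < 2 * ((i : ℝ) + 1) + a := by linarith
      have k1' : 0 < (j : ℝ) + 1 + a - 1 := by linarith
      have k2' : 0 < 2 * ((j : ℝ) + 1) + a := by linarith
      have k3 : 0 < b * (2 * ((i : ℝ) + 1) + a) * (i + 1 + 1) * (i + 1 + a - 1) := by positivity
      have k4 : 0 < b * (2 * ((j : ℝ) + 1) + a) * (j + 1 + 1) * (j + 1 + a - 1) := by positivity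
      have q2 : middleQuad a (m * (m + a)) (n * (n + a)) ((j + 1) * (j + 1 + a)) ≤ 0 := by
        by_contra hc
        have := mul_pos k4 (not_le.mp hc)
        exact absurd hBj (not_le.mpr this)
      have hmono : ((i : ℝ) + 1) * (i + 1 + a) ≤ (j + 1) * (j + 1 + a) :=
        mul_le_mul (by linarith) (by linarith) (by linarith) (by linarith)
      have q1 : middleQuad a (m * (m + a)) (n * (n + a)) ((i + 1) * (i + 1 + a)) ≤ 0 := by
        rcases Nat.eq_zero_or_pos d with hd0 | hd0
        · have hq := hquad hd0
          have hnm : (n : ℝ) = m := by rw [hn', hd0]; simp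
          rw [hnm] at q2 ⊢
          refine middleQuad_nonpos_of_le ?_ hmono hq q2
          have : (0 : ℝ) ≤ i := i.cast_nonneg
          exact mul_le_mul (by linarith) (by linarith) (by linarith) (by linarith)
        · have hd1 : (1 : ℝ) ≤ d := by exact_mod_cast hd0
          have hq := middleQuad_sub_nonpos ha1 (by linarith : (0:ℝ) ≤ m) hd1
          rw [← hn'] at hq
          refine middleQuad_nonpos_of_le ?_ hmono hq q2
          exact mul_le_mul (by linarith) (by linarith) (by linarith) (by linarith)
      exact mul_nonpos_of_nonneg_of_nonpos k3.le q1

theorem tripleE_nonneg_of_le (hα : -1 < α) (hβ : -1 < β) (ha : a = α + β + 1)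
    (hb : b = α - β) (hb0 : 0 ≤ b)
    (hV : (a ^ 2 - 7 * a - 24) * b ^ 2 ≤ a * (a + 5) * (a + 3) ^ 2) (m d k : ℕ) :
    0 ≤ tripleE α β m (m + d) k := by
  have ha1 : -1 < a := by linarith
  have hla : -(31 / 100) ≤ a := neg_le_of_gasper ha1 hb0 (by linarith) hV
  rcases lt_or_ge (m + (m + d)) k with h | h
  · rw [tripleE_eq_zero hα hβ h]
  rcases lt_or_ge k d with h' | h'
  · rw [tripleE_swap', tripleE_eq_zero hα hβ (by omega)]
  have l0 : 0 ≤ tripleE α β m (m + d) (m + (m + d)) := (tripleE_pos hα hβ m (m + d)).le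
  have l0' : 0 ≤ tripleE α β m (m + d) d := by
    rw [tripleE_swap']; exact (tripleE_pos hα hβ m d).le
  rcases Nat.eq_zero_or_pos m with hm | hm
  · obtain rfl : k = d := by omega
    exact l0'
  have l1 : ∀ i, i + 1 = m + (m + d) → 0 ≤ tripleE α β m (m + d) i := fun i hi =>
    tripleE_top_pred_nonneg hα hβ ha hb hb0 hm (by omega) hi.symm
  have l1' : 0 ≤ tripleE α β m (m + d) (d + 1) := by
    -- By symmetry the value just above the bottom, at d + 1, is the value just below the top for
    -- the pair (m, d + 1). The same device is used for d + 2.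
    rw [tripleE_swap']
    exact tripleE_top_pred_nonneg hα hβ ha hb hb0 hm (by omega) (by omega)
  have hmr : (1 : ℝ) ≤ m := by exact_mod_cast hm
  -- For a > 0 the recurrence coefficients are positive on the whole range; for a ≤ 0 the outermost
  -- ones contain the factor a.
  rcases lt_or_ge 0 a with ha0 | ha0
  · exact tripleE_nonneg_of_ends hα hβ ha hb hb0 hm le_rfl (by linarith)
      le_rfl (by push_cast; linarith)
      (fun _ => middleQuad_diag_nonpos hla hmr (Or.inl ha0)) l0' l1' l1 l0 h' h
  · have l2 : ∀ p q j : ℕ, 2 ≤ p → 2 ≤ q → p + q = j + 2 → 0 ≤ tripleE α β p q j := by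
      intro p q j hp hq hj
      rw [tripleE_top_pred_pred_nonneg_iff hα hβ ha hb hp hq hj]
      refine topFactor_nonneg hla ha0 ?_ (by exact_mod_cast hp) (by exact_mod_cast hq)
      rw [topFactor_two_two]; linarith
    rcases eq_or_lt_of_le h' with rfl | h1
    · exact l0'
    rcases eq_or_lt_of_le h with rfl | h2
    · exact l0
    -- For m ≤ 2 the explicit values near the ends already cover the whole range.
    rcases (by omega : m = 1 ∨ m = 2 ∨ 3 ≤ m) with rfl | rfl | hm3
    · obtain rfl : k = d + 1 := by omega
      exact l1'
    · rcases (by omega : k = d + 1 ∨ k = d + 2 ∨ k + 1 = 2 + (2 + d)) with rfl | rfl | h3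
      · exact l1'
      · exact l2 _ _ _ le_rfl (by omega) (by omega)
      · exact l1 _ h3
    · have hm3' : (3 : ℝ) ≤ m := by exact_mod_cast hm3
      refine tripleE_nonneg_of_ends hα hβ ha hb hb0 hm (s := d + 1) (t := m + (m + d) - 1)
        (by omega) (by push_cast; linarith) (by omega) ?_
        (fun _ => middleQuad_diag_nonpos hla hmr (Or.inr hm3')) l1' ?_ ?_ (l1 _ (by omega))
        (by omega) (by omega)
      · rw [Nat.cast_sub (by omega)]; push_cast; linarith
      · rw [tripleE_swap']
        exact l2 _ _ _ (by omega) (by omega) (by omega)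
      · intro i hi
        exact l2 _ _ _ (by omega) (by omega) (by omega)

theorem tripleE_nonneg (hα : -1 < α) (hβ : -1 < β) (ha : a = α + β + 1)
    (hb : b = α - β) (hb0 : 0 ≤ b)
    (hV : (a ^ 2 - 7 * a - 24) * b ^ 2 ≤ a * (a + 5) * (a + 3) ^ 2) (m n k : ℕ) :
    0 ≤ tripleE α β m n k := by
  rcases le_total m n with h | h
  · obtain ⟨d, rfl⟩ := Nat.exists_eq_add_of_le h
    exact tripleE_nonneg_of_le hα hβ ha hb hb0 hV m d k
  · obtain ⟨d, rfl⟩ := Nat.exists_eq_add_of_le h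
    rw [tripleE_swap]
    exact tripleE_nonneg_of_le hα hβ ha hb hb0 hV n d k

end tripleE_nonneg

/-! ### Nonnegativity for two odd indices -/

section tripleO_nonneg

variable {α β a b : ℝ}

theorem tripleO_add_one_sub_tripleO (hα : -1 < α) (hβ : -1 < β) (m n k : ℕ) :
    (m + α + β + 1) * (n + α + β + 1) * (m + n - k + 1) * tripleO α β k m n -
      (n + α + β + 1) * (k + α + β + 1) * (n + k - m + 1) * tripleO α β m n k =
      (m - k) * (n + β + 1) * (m + n + k + 2 * (α + β + 1)) * tripleE α β m n k := by
  linear_combination tripleO_sub_tripleO hα hβ m n k +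
    ((m : ℝ) - k) * (n + α + β + 1) * tripleO_add_tripleO hα hβ m n k

theorem tripleO_top_eq (hα : -1 < α) (hβ : -1 < β) {n k : ℕ} (hn : 1 ≤ n) :
    (2 * (n + k) + α + β + 2) * (n + α + β + 1) * tripleO α β k n (n + k) =
      (2 * n + α + β + 1) * (n + k + 1 + β) * tripleE α β n k (n + k) := by
  have h1 := tripleZ_eq_tripleE (β := β) hα (n + k) n k
  rw [tripleE_swap α β (n + k + 1), tripleE_swap' α β n (n + k + 1),
    tripleE_eq_zero hα hβ (by omega : n + k < n + k + 1), tripleE_swap α β (n + k),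
    tripleE_swap' α β n (n + k)] at h1
  have h2 := tripleZ_eq_tripleO (α := α) (β := β) (n + k) n k
  rw [tripleO_swap α β k (n - 1), tripleO_eq_zero_of_lt hα hβ
    (by omega : k + (n - 1) < n + k)] at h2
  push_cast at h1
  linear_combination -(2 * ((n : ℝ) + k) + α + β + 2) * h2 + (2 * (n : ℝ) + α + β + 1) * h1

theorem tripleE_top_succ_eq (hα : -1 < α) (hβ : -1 < β) (n : ℕ) :
    (α + β + 2) * (n + 1) * tripleO α β n 0 n =
      (2 * n + α + β + 3) * (1 + α) * tripleE α β 1 n (1 + n) := by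
  have h3 := tripleZ_eq_tripleO (α := α) (β := β) 0 (n + 1) n
  rw [tripleO_eq_zero_of_lt hα hβ (by omega : n + 0 < n + 1), Nat.add_sub_cancel,
    tripleO_swap α β n n] at h3
  have h4 := tripleZ_eq_tripleE (β := β) hα 0 (n + 1) n
  rw [tripleE_swap' α β 0, tripleE_eq_zero hα hβ (by omega : 0 + n < n + 1),
    tripleE_swap' α β (0 + 1), zero_add, add_comm n 1] at h4
  push_cast at h3 h4
  rw [add_comm n 1] at h3
  linear_combination -(α + β + 2) * h3 + (2 * (n : ℝ) + α + β + 3) * h4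

/-- The case m = n + k, where the weight of `tripleE` in the induction step carries the factor a and
may be negative. -/
theorem tripleO_top_pred_eq (hα : -1 < α) (hβ : -1 < β) (ha : a = α + β + 1) (hb : b = α - β)
    {n k : ℕ} (hn : 1 ≤ n) :
    2 * (k + a) * (n + a) * (2 * (n + k) + a + 1) * tripleO α β (n + k) n k =
      (n + k + a) * (a * (2 * (n + k) + a + 1) + b * (4 * (n * k) - a)) *
        tripleE α β n k (n + k) := by
  have h1 := tripleO_add_one_sub_tripleO hα hβ (n + k) n k
  have h2 := tripleO_top_eq (k := k) hα hβ hn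
  rw [tripleE_swap α β (n + k), tripleE_swap' α β n (n + k), tripleO_swap α β k (n + k)] at h1
  push_cast at h1
  have hα' : α = (a - 1 + b) / 2 := by rw [ha, hb]; ring
  have hβ' : β = (a - 1 - b) / 2 := by rw [ha, hb]; ring
  clear ha hb
  generalize tripleE α β n k (n + k) = x1 at *
  generalize tripleO α β k n (n + k) = p1 at *
  generalize tripleO α β (n + k) n k = p0 at *
  subst hα' hβ'
  linear_combination -2 * (2 * ((n : ℝ) + k) + a + 1) * h1 +
    2 * ((n : ℝ) + k + a) * (2 * n + 1) * h2

/-- The other exceptional case, m = 1 with equal odd indices: the weight of the lower `tripleO` is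
then a multiple of a. -/
theorem tripleO_one_eq (hα : -1 < α) (hβ : -1 < β) (ha : a = α + β + 1) (hb : b = α - β)
    {n : ℕ} (hn : 1 ≤ n) :
    2 * (n + a) * (n + 1) * (1 + a) * tripleO α β 1 n n =
      (a * (1 + a + b) + 4 * b * (n * (n + 1 + a))) * tripleE α β 1 n (1 + n) := by
  have h1 := tripleO_eq_tripleO_add_tripleE hα hβ 1 n n
  have h2 := tripleE_top_succ_eq hα hβ n
  have h3 := tripleE_top_pred hα hβ ha hb (m := 1) (n := n) (j := n) le_rfl hn (by omega)
  have hn' : (1 : ℝ) ≤ n := by exact_mod_cast hn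
  rw [Nat.sub_self] at h1
  push_cast at h1 h3
  have h4 : ((n : ℝ) + a) * (2 * n + a + 2) ≠ 0 := by
    have : 0 < (n : ℝ) + a := by linarith
    have : 0 < 2 * (n : ℝ) + a + 2 := by linarith
    positivity
  have hα' : α = (a - 1 + b) / 2 := by rw [ha, hb]; ring
  have hβ' : β = (a - 1 - b) / 2 := by rw [ha, hb]; ring
  clear ha hb
  generalize tripleE α β 1 n (1 + n) = x1 at *
  generalize tripleE α β 1 n n = x0 at *
  generalize tripleO α β n 0 n = p1 at *
  generalize tripleO α β 1 n n = p0 at *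
  subst hα' hβ'
  apply mul_left_cancel₀ h4
  linear_combination 2 * ((n : ℝ) + 1) * (1 + a) * h1 + 2 * ((n : ℝ) + a) * a * h2 +
    2 * ((n : ℝ) + 1 + a) * h3

/-- For small -a the boundary of V has b of order √(-a), well above -2a. This linear bound is enough
for both exceptional cases. -/
theorem neg_two_mul_le_of_gasper (ha : -(31 / 100) ≤ a) (ha0 : a ≤ 0) (hb0 : 0 ≤ b)
    (hV : (a ^ 2 - 7 * a - 24) * b ^ 2 ≤ a * (a + 5) * (a + 3) ^ 2) : -2 * a ≤ b := by
  by_contra hc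
  push Not at hc
  have h1 : b ^ 2 ≤ (2 * a) ^ 2 := by nlinarith
  have h2 : (24 + 7 * a - a ^ 2) * b ^ 2 ≤ (24 + 7 * a - a ^ 2) * (2 * a) ^ 2 :=
    mul_le_mul_of_nonneg_left h1 (by nlinarith)
  have h3 : 0 < -a := by linarith
  have h4 : 0 ≤ -a * ((24 + 7 * a - a ^ 2) * (-4 * a) - (a + 5) * (a + 3) ^ 2) := by
    nlinarith
  have h5 := nonneg_of_mul_nonneg_right h4 h3
  nlinarith [sq_nonneg a, mul_nonneg h3.le (sq_nonneg a)]

theorem tripleO_nonneg (hα : -1 < α) (hβ : -1 < β) (ha : a = α + β + 1)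
    (hb : b = α - β) (hb0 : 0 ≤ b)
    (hV : (a ^ 2 - 7 * a - 24) * b ^ 2 ≤ a * (a + 5) * (a + 3) ^ 2) (m n k : ℕ) :
    0 ≤ tripleO α β m n k := by
  have ha1 : -1 < a := by linarith
  have hla : -(31 / 100) ≤ a := neg_le_of_gasper ha1 hb0 (by linarith) hV
  have hE := tripleE_nonneg hα hβ ha hb hb0 hV
  have key : ∀ N m n k : ℕ, m + n + k ≤ N → 0 ≤ tripleO α β m n k := by
    intro N
    induction N with
    | zero =>
      intro m n k h
      obtain rfl : m = 0 := by omega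
      obtain rfl : n = 0 := by omega
      obtain rfl : k = 0 := by omega
      simpa using (tripleO_pos hα hβ 0 0).le
    | succ N ih =>
      have main : ∀ m n k : ℕ, k ≤ n → m + n + k ≤ N + 1 → 0 ≤ tripleO α β m n k := by
        intro m n k hkn hN
        -- For k = 0 the general step would divide by k + a, which may not be positive; here the
        -- integral is directly a positive combination of two `tripleE`.
        rcases Nat.eq_zero_or_pos k with rfl | hk
        · have e : tripleO α β m n 0 = tripleZ α β n m 0 := by
            simp only [tripleO, tripleZ, jacobiY_zero, mul_one]
            rw [mul_comm (jacobiY α β m)]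
          have h := tripleZ_eq_tripleE (β := β) hα n m 0
          have hn : (0 : ℝ) ≤ n := n.cast_nonneg
          rw [e]
          have p1 : 0 < 2 * (n : ℝ) + α + β + 2 := by linarith
          refine nonneg_of_mul_nonneg_right ?_ p1
          rw [h]
          exact add_nonneg (mul_nonneg (by linarith) (hE _ _ _))
            (mul_nonneg (by linarith) (hE _ _ _))
        have hk' : (1 : ℝ) ≤ k := by exact_mod_cast hk
        have hkn' : (k : ℝ) ≤ n := by exact_mod_cast hkn
        have hm' : (0 : ℝ) ≤ m := m.cast_nonneg
        have step : 0 ≤ (m : ℝ) * (m + n - k + a - 1) →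
            0 ≤ ((n : ℝ) + k - m + a) * tripleE α β m k n → 0 ≤ tripleO α β m n k := by
          intro c1 c2
          have h := tripleO_eq_tripleO_add_tripleE hα hβ m k n
          have p1 : 0 < ((n : ℝ) + α + β + 1) * (k + α + β + 1) * (m + k + n + α + β + 2) :=
            mul_pos (mul_pos (by linarith) (by linarith)) (by linarith)
          rw [tripleO_swap]
          refine nonneg_of_mul_nonneg_right ?_ p1
          rw [h]
          have t1 : 0 ≤ (m : ℝ) * (m + n - k + a - 1) *
              ((k + a) * tripleO α β n (m - 1) k) := by
            rcases Nat.eq_zero_or_pos m with rfl | hm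
            · simp
            · exact mul_nonneg c1 (mul_nonneg (by linarith) (ih _ _ _ (by omega)))
          have t2 : 0 ≤ ((m : ℝ) + n + a) * (k + β + 1) *
              (((n : ℝ) + k - m + a) * tripleE α β m k n) :=
            mul_nonneg (mul_nonneg (by linarith) (by linarith)) c2
          have := add_nonneg t1 t2
          rw [ha] at this
          convert this using 1
          ring
        rcases Nat.lt_or_ge (n + k) m with h1 | h1
        · have h1' : (n : ℝ) + k < m := by exact_mod_cast h1
          refine step (mul_nonneg hm' (by linarith)) ?_
          rw [tripleE_swap, tripleE_swap', tripleE_eq_zero hα hβ (by omega : k + n < m), mul_zero]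
        have h1' : (m : ℝ) ≤ n + k := by exact_mod_cast h1
        rcases le_or_gt 0 a with ha0 | ha0
        · refine step ?_ (mul_nonneg (by linarith) (hE _ _ _))
          rcases Nat.eq_zero_or_pos m with rfl | hm
          · simp
          · have : (1 : ℝ) ≤ m := by exact_mod_cast hm
            exact mul_nonneg hm' (by linarith)
        have hab := neg_two_mul_le_of_gasper hla ha0.le hb0 hV
        rcases eq_or_lt_of_le h1 with h2 | h2
        · have h := tripleO_top_pred_eq (k := k) hα hβ ha hb (le_trans hk hkn)
          rw [h2]
          have p1 : 0 < 2 * ((k : ℝ) + a) * (n + a) * (2 * (n + k) + a + 1) :=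
            mul_pos (mul_pos (by linarith) (by linarith)) (by linarith)
          refine nonneg_of_mul_nonneg_right ?_ p1
          rw [h]
          refine mul_nonneg (mul_nonneg (by linarith) ?_) (hE _ _ _)
          have q1 : (n : ℝ) ≤ n * k := by nlinarith
          have q2 : (k : ℝ) ≤ n * k := by nlinarith
          have q3 : (-2 * a) * (4 * (n * k) - a) ≤ b * (4 * (n * k) - a) :=
            mul_le_mul_of_nonneg_right hab (by nlinarith)
          have q4 : 0 ≤ (-a) * (8 * (n * k) - 2 * (n + k) - 1 - 3 * a) :=
            mul_nonneg (by linarith) (by linarith)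
          nlinarith
        · have h2' : (m : ℝ) + 1 ≤ n + k := by exact_mod_cast h2
          have c2 : 0 ≤ ((n : ℝ) + k - m + a) * tripleE α β m k n :=
            mul_nonneg (by linarith) (hE _ _ _)
          rcases (by omega : m = 0 ∨ (m = 1 ∧ n = k) ∨ k + 2 ≤ m + n) with rfl | ⟨rfl, rfl⟩ | h3
          · exact step (by simp) c2
          · have h := tripleO_one_eq hα hβ ha hb hk
            have p1 : 0 < 2 * ((n : ℝ) + a) * (n + 1) * (1 + a) :=
              mul_pos (mul_pos (by linarith) (by linarith)) (by linarith)
            refine nonneg_of_mul_nonneg_right ?_ p1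
            rw [h]
            refine mul_nonneg ?_ (hE _ _ _)
            have q1 : (1 : ℝ) ≤ n * (n + 1 + a) := by nlinarith
            have q2 : b * 1 ≤ b * (n * (n + 1 + a)) := mul_le_mul_of_nonneg_left q1 hb0
            nlinarith
          · have h3' : (k : ℝ) + 2 ≤ m + n := by exact_mod_cast h3
            exact step (mul_nonneg hm' (by linarith)) c2
      intro m n k h
      rcases le_total k n with hkn | hkn
      · exact main m n k hkn h
      · rw [tripleO_swap]
        exact main m k n hkn (by omega)
  exact key _ m n k le_rfl

end tripleO_nonneg

/-! ### Return to the variable x -/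

section generalized_chebyshev

variable {α β : ℝ}

theorem jacobi_comp (n : ℕ) :
    (jacobi α β n).comp (2 * X ^ 2 - 1) = (jacobiY α β n).comp (1 - X ^ 2) := by
  rw [jacobi, jacobiY, Polynomial.sum_comp, Polynomial.sum_comp]
  refine Finset.sum_congr rfl fun k _ => ?_
  have e : (1 - (2 * X ^ 2 - 1) : ℝ[X]) = C 2 * (1 - X ^ 2) := by
    rw [show (C 2 : ℝ[X]) = 2 from rfl]; ring
  have h2 : (2 : ℝ) ^ k ≠ 0 := by positivity
  simp only [mul_comp, C_comp, pow_comp, sub_comp, one_comp, X_comp]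
  rw [e, mul_pow, ← mul_assoc, ← C_pow, ← C_mul]
  congr 2
  rw [jacobiCoeff]
  field_simp

theorem genChebyshev_two_mul (n : ℕ) :
    genChebyshev α β (2 * n) = (jacobiY α β n).comp (1 - X ^ 2) := by
  rw [genChebyshev_even, jacobi_comp]

theorem genChebyshev_two_mul_add_one (n : ℕ) :
    genChebyshev α β (2 * n + 1) = X * (jacobiY α (β + 1) n).comp (1 - X ^ 2) := by
  rw [genChebyshev_odd, jacobi_comp]

/-- The functional on polynomials in `x` that vanishes on odd polynomials and agrees with
`jacobiFunctional` on polynomials in `1 - x²`. -/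
def chebFunctional (α β : ℝ) : ℝ[X] →ₗ[ℝ] ℝ :=
  (Polynomial.basisMonomials ℝ).constr ℝ fun n =>
    if Even n then jacobiFunctional α β ((1 - X) ^ (n / 2)) else 0

theorem chebFunctional_X_pow (n : ℕ) : chebFunctional α β (X ^ n) =
    if Even n then jacobiFunctional α β ((1 - X) ^ (n / 2)) else 0 := by
  have := (Polynomial.basisMonomials ℝ).constr_basis ℝ (fun n =>
    if Even n then jacobiFunctional α β ((1 - X) ^ (n / 2)) else 0) n
  simpa [chebFunctional, ← X_pow_eq_monomial] using this

theorem chebFunctional_comp (f : ℝ[X]) :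
    chebFunctional α β (f.comp (1 - X ^ 2)) = jacobiFunctional α β f ∧
      chebFunctional α β (X * f.comp (1 - X ^ 2)) = 0 := by
  -- The substitution X ↦ 1 - X is an involution, so it suffices to treat monomials in x².
  have e1 : f = (f.comp (1 - X)).comp (1 - X) := by simp [comp_assoc]
  have e2 : f.comp (1 - X ^ 2) = (f.comp (1 - X)).comp (X ^ 2) := by simp [comp_assoc]
  rw [e2]
  nth_rewrite 2 [e1]
  generalize f.comp (1 - X) = g
  induction g using Polynomial.induction_on' with
  | add p q hp hq =>
    simp only [add_comp, mul_add, map_add, hp.1, hp.2, hq.1, hq.2]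
    simp
  | monomial n c =>
    have h1 : ((monomial n c : ℝ[X])).comp (X ^ 2) = C c * X ^ (2 * n) := by
      rw [← C_mul_X_pow_eq_monomial, mul_comp, C_comp, X_pow_comp, pow_mul]
    have h2 : ((monomial n c : ℝ[X])).comp (1 - X) = C c * (1 - X) ^ n := by
      rw [← C_mul_X_pow_eq_monomial, mul_comp, C_comp, X_pow_comp]
    have h3 : (X * (C c * X ^ (2 * n)) : ℝ[X]) = C c * X ^ (2 * n + 1) := by ring
    rw [h1, h2, h3, map_C_mul, map_C_mul, map_C_mul, chebFunctional_X_pow, chebFunctional_X_pow]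
    simp

theorem chebFunctional_even_even_even (m n k : ℕ) :
    chebFunctional α β (genChebyshev α β (2 * m) * genChebyshev α β (2 * n) *
      genChebyshev α β (2 * k)) = tripleE α β m n k := by
  rw [tripleE, ← (chebFunctional_comp _).1]
  simp only [genChebyshev_two_mul, mul_comp]

theorem chebFunctional_even_odd_odd (m n k : ℕ) :
    chebFunctional α β (genChebyshev α β (2 * m) * genChebyshev α β (2 * n + 1) *
      genChebyshev α β (2 * k + 1)) = tripleO α β m n k := by
  rw [tripleO, ← (chebFunctional_comp _).1]
  congr 1
  simp only [genChebyshev_two_mul, genChebyshev_two_mul_add_one, mul_comp, sub_comp, one_comp,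
    X_comp]
  ring

theorem chebFunctional_even_even_odd (m n k : ℕ) :
    chebFunctional α β (genChebyshev α β (2 * m) * genChebyshev α β (2 * n) *
      genChebyshev α β (2 * k + 1)) = 0 := by
  rw [← (chebFunctional_comp (jacobiY α β m * jacobiY α β n * jacobiY α (β + 1) k)).2]
  congr 1
  simp only [genChebyshev_two_mul, genChebyshev_two_mul_add_one, mul_comp]
  ring

theorem chebFunctional_odd_odd_odd (m n k : ℕ) :
    chebFunctional α β (genChebyshev α β (2 * m + 1) * genChebyshev α β (2 * n + 1) *
      genChebyshev α β (2 * k + 1)) = 0 := by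
  rw [← (chebFunctional_comp ((1 - X) *
    (jacobiY α (β + 1) m * jacobiY α (β + 1) n * jacobiY α (β + 1) k))).2]
  congr 1
  simp only [genChebyshev_two_mul_add_one, mul_comp, sub_comp, one_comp, X_comp]
  ring

theorem chebFunctional_triple_nonneg (hE : ∀ m n k, 0 ≤ tripleE α β m n k)
    (hO : ∀ m n k, 0 ≤ tripleO α β m n k) (i j l : ℕ) :
    0 ≤ chebFunctional α β (genChebyshev α β i * genChebyshev α β j * genChebyshev α β l) := by
  obtain ⟨m, rfl | rfl⟩ := i.even_or_odd' <;> obtain ⟨n, rfl | rfl⟩ := j.even_or_odd' <;>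
    obtain ⟨k, rfl | rfl⟩ := l.even_or_odd'
  · rw [chebFunctional_even_even_even]; exact hE _ _ _
  · rw [chebFunctional_even_even_odd]
  · rw [mul_right_comm, chebFunctional_even_even_odd]
  · rw [chebFunctional_even_odd_odd]; exact hO _ _ _
  · rw [mul_assoc, mul_comm, chebFunctional_even_even_odd]
  · rw [mul_comm (genChebyshev α β (2 * m + 1)), chebFunctional_even_odd_odd]; exact hO _ _ _
  · rw [mul_comm, ← mul_assoc, chebFunctional_even_odd_odd]; exact hO _ _ _
  · rw [chebFunctional_odd_odd_odd]

theorem genChebyshev_zero : genChebyshev α β 0 = 1 := by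
  have := genChebyshev_two_mul (α := α) (β := β) 0
  simpa [jacobiY_zero] using this

theorem natDegree_comp_one_sub_X_sq (f : ℝ[X]) :
    (f.comp (1 - X ^ 2)).natDegree = 2 * f.natDegree := by
  have h : (1 - X ^ 2 : ℝ[X]).natDegree = 2 := by
    rw [← neg_sub, natDegree_neg]
    exact natDegree_X_pow_sub_C
  rw [natDegree_comp, h, mul_comm]

theorem natDegree_jacobiY (hα : -1 < α) (hβ : -1 < β) (n : ℕ) : (jacobiY α β n).natDegree = n :=
  natDegree_eq_of_le_of_coeff_ne_zero (natDegree_jacobiY_le n)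
    (by rw [coeff_jacobiY]; exact leadingCoeff_jacobiY_ne_zero hα hβ n)

theorem natDegree_genChebyshev (hα : -1 < α) (hβ : -1 < β) (n : ℕ) :
    (genChebyshev α β n).natDegree = n := by
  obtain ⟨k, rfl | rfl⟩ := n.even_or_odd'
  · rw [genChebyshev_two_mul, natDegree_comp_one_sub_X_sq, natDegree_jacobiY hα hβ]
  · have h : (jacobiY α (β + 1) k).comp (1 - X ^ 2) ≠ 0 := by
      intro h0
      have h1 := natDegree_comp_one_sub_X_sq (jacobiY α (β + 1) k)
      rw [h0, natDegree_jacobiY hα (by linarith), natDegree_zero] at h1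
      obtain rfl : k = 0 := by omega
      simp [jacobiY_zero] at h0
    rw [genChebyshev_two_mul_add_one, natDegree_X_mul h, natDegree_comp_one_sub_X_sq,
      natDegree_jacobiY hα (by linarith)]

theorem coeff_genChebyshev_ne_zero (hα : -1 < α) (hβ : -1 < β) (n : ℕ) :
    (genChebyshev α β n).coeff n ≠ 0 := by
  have h := natDegree_genChebyshev hα hβ n
  have h0 : genChebyshev α β n ≠ 0 := by
    intro h0
    rw [h0, natDegree_zero] at h
    rw [← h, genChebyshev_zero] at h0
    exact one_ne_zero h0
  nth_rewrite 2 [← h]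
  rwa [coeff_natDegree, leadingCoeff_ne_zero]

theorem chebFunctional_orthogonal (hα : -1 < α) (hβ : -1 < β) {i j : ℕ} (hij : i ≠ j) :
    chebFunctional α β (genChebyshev α β i * genChebyshev α β j) = 0 := by
  -- Inserting T_0 = 1 turns the pairing into a triple integral, whose vanishing is already known.
  have h0 : genChebyshev α β i * genChebyshev α β j =
      genChebyshev α β (2 * 0) * genChebyshev α β i * genChebyshev α β j := by
    rw [mul_zero, genChebyshev_zero, one_mul]
  rw [h0]
  obtain ⟨m, rfl | rfl⟩ := i.even_or_odd' <;> obtain ⟨n, rfl | rfl⟩ := j.even_or_odd'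
  · rw [chebFunctional_even_even_even]
    rcases lt_or_gt_of_ne hij with h | h
    · exact tripleE_eq_zero hα hβ (by omega)
    · rw [tripleE_swap']; exact tripleE_eq_zero hα hβ (by omega)
  · rw [chebFunctional_even_even_odd]
  · rw [mul_right_comm, chebFunctional_even_even_odd]
  · rw [chebFunctional_even_odd_odd]
    rcases lt_or_gt_of_ne hij with h | h
    · rw [tripleO_swap]; exact tripleO_eq_zero_of_lt hα hβ (by omega)
    · exact tripleO_eq_zero_of_lt hα hβ (by omega)

theorem chebFunctional_norm_pos (hα : -1 < α) (hβ : -1 < β) (i : ℕ) :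
    0 < chebFunctional α β (genChebyshev α β i * genChebyshev α β i) := by
  have h0 : genChebyshev α β i * genChebyshev α β i =
      genChebyshev α β (2 * 0) * genChebyshev α β i * genChebyshev α β i := by
    rw [mul_zero, genChebyshev_zero, one_mul]
  rw [h0]
  obtain ⟨m, rfl | rfl⟩ := i.even_or_odd'
  · rw [chebFunctional_even_even_even]
    simpa using tripleE_pos hα hβ 0 m
  · rw [chebFunctional_even_odd_odd]
    exact tripleO_pos hα hβ m 0

end generalized_chebyshev
end GenCheb
end

/-! ### The equivalence -/

/-- The product expansions of the generalized Chebyshev polynomials exist with unique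
coefficients, and these are all nonnegative if and only if `(α, β)` lies in Gasper's set. -/
theorem theorem3p2 (α β : ℝ) (hα : -1 < α) (hβ : -1 < β) :
    (∃! g : ℕ → ℕ → ℕ → ℝ, GenCheb.IsLinearization (GenCheb.genChebyshev α β) g) ∧
    ∀ g : ℕ → ℕ → ℕ → ℝ, GenCheb.IsLinearization (GenCheb.genChebyshev α β) g →
      ((∀ m n k : ℕ, 0 ≤ g m n k) ↔ (α, β) ∈ GenCheb.gasperV) := by
  have hlin := fun g : ℕ → ℕ → ℕ → ℝ => GenCheb.isLinearization_iff (g := g)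
    (fun n => (GenCheb.natDegree_genChebyshev hα hβ n).le)
    (GenCheb.coeff_genChebyshev_ne_zero hα hβ)
    (fun _ _ h => GenCheb.chebFunctional_orthogonal hα hβ h)
    (GenCheb.chebFunctional_norm_pos hα hβ)
  constructor
  · refine ⟨_, (hlin _).mpr fun m n k => rfl, fun g hg => ?_⟩
    funext m n k
    exact (hlin g).mp hg m n k
  intro g hg
  have hg' := (hlin g).mp hg
  constructor
  · intro hpos
    have hE : ∀ m n k : ℕ, 0 ≤ GenCheb.tripleE α β m n k := by
      intro m n k
      have h := hpos (2 * m) (2 * n) (2 * k)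
      rw [hg', GenCheb.chebFunctional_even_even_even] at h
      have h1 := GenCheb.chebFunctional_norm_pos hα hβ (2 * k)
      have h2 := mul_nonneg h h1.le
      rwa [div_mul_cancel₀ _ h1.ne'] at h2
    -- The coefficients g(2,2;2) and g(4,4;4) alone force the two conditions defining V.
    have hb := GenCheb.nonneg_of_tripleE_one_nonneg hα hβ rfl rfl (hE 1 1 1)
    have hV := (GenCheb.tripleE_top_pred_pred_nonneg_iff hα hβ rfl rfl (m := 2) (n := 2) (j := 2)
      le_rfl le_rfl rfl).mp (hE 2 2 2)
    push_cast at hV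
    rw [GenCheb.topFactor_two_two] at hV
    refine ⟨hα, hβ, ?_, hb⟩
    show _ ≤ _
    linarith
  · rintro ⟨-, -, hV, hb⟩ m n k
    rw [hg']
    exact div_nonneg (GenCheb.chebFunctional_triple_nonneg
      (GenCheb.tripleE_nonneg hα hβ rfl rfl hb hV) (GenCheb.tripleO_nonneg hα hβ rfl rfl hb hV)
      m n k) (GenCheb.chebFunctional_norm_pos hα hβ k).le
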